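/- All graphs are finite and may have loops and parallel edges. A delta-matroid is a pair $(E,\mathcal F)$ of a finite set $E$ and a nonempty set $\mathcal F$ of subsets of $E$ (the feasible sets) such that for all $A,B\in\mathcal F$ and $x\in A\triangle B$ there is $y\in A\triangle B$ (possibly $y=x$) with $A\triangle\{x,y\}\in\mathcal F$. For $X\subseteq E$ put $(E,\mathcal F)\triangle X=(E,\{F\triangle X:F\in\mathcal F\})$. A delta-matroid $(E,\mathcal F)$ is connected if there is no partition of $E$ into nonempty sets $E_1,E_2$ with delta-matroids $(E_1,\mathcal F_1)$, $(E_2,\mathcal F_2)$ such that $\mathcal F=\{F_1\cup F_2:F_1\in\mathcal F_1,F_2\in\mathcal F_2\}$. It is a twisted matroid if it equals $(E,\mathcal B)\triangle Y$ for some $Y\subseteq E$, where $\mathcal B$ is the set of bases of a matroid on $E$. A graft is a pair $(G,T)$ of a graph $G$ and a set $T\subseteq V(G)$. The pair $\mathcal G(G,T)=(E(G),\mathcal F)$ is given by: $F\in\mathcal F$ if and only if $F$ is the edge set of a forest $H\subseteq G$ with $V(H)=V(G)$ such that for each component $C$ of $H$, either $|V(C)\cap T|$ is odd, or $V(C)\cap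 T=\emptyset$ and $G[V(C)]$ is a component of $G$. A delta-matroid is graphic if it equals $\mathcal G(G,T)\triangle X$ for some graft $(G,T)$ and some $X\subseteq E(G)$. A cyclic decomposition of $(G,T)$ is a pair $(H,(B_x)_{x\in V(H)})$ of a bipartite graph $H$ of maximum degree at most $2$ and sets $B_x\subseteq V(G)$ such that (C1) $\bigcup_{x\in V(H)}B_x=V(G)$; (C2) whenever $u,v$ are adjacent in $G$, some $B_x$ contains both; (C3) for distinct $x,y\in V(H)$, $B_x\cap B_y\subseteq T$ and $|B_x\cap B_y|$ is the number of edges of $H$ joining $x$ and $y$; (C4) $|T\cap B_x|\le 2$ for all $x\in V(H)$. It is nice if moreover (N1) $G[B_x]$ is connected for every $x\in V(H)$, and (N2) every $x\in V(H)$ with $|B_x\cap T|\le1$ is an isolated vertex of $H$. **Proposition.** Let $M$ be a connected graphic delta-matroid such that $M=\mathcal G(G,T)\triangle X$ for a graft $(G,T)$, where $X\subseteq E(G)$ and $G$ has no isolated vertices. Then $M$ is a twisted matroid if and only if at least one of the following holds: (G1) $|T|\le 2$; (G2) $(G,T)$ admits a nice cyclic decomposition $(H,\mathcal B)$ in which $H$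 is an even cycle of length at least $4$; (G3) $(G,T)$ admits a nice cyclic decomposition $(H,\mathcal B)$ in which $H$ is a path of length at least $1$. -/

import Mathlib

/-!
Finite multigraphs are terms `G : Graph α β` of Mathlib (loops and parallel edges allowed) with
finite vertex set and finite edge set; `H ≤ G` means that `H` is a subgraph of `G`.
-/

namespace DeltaGraphic

open scoped Graph

section Graphs

variable {α β : Type*}

/-- `G` is connected: it has a vertex, and any two of its vertices are joined by a walk. -/
def IsConnectedGraph (G : Graph α β) : Prop :=
  V(G).Nonempty ∧ ∀ x ∈ V(G), ∀ y ∈ V(G), Relation.ReflTransGen G.Adj x y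

/-- `C` is a (connected) component of `G`: a maximal connected subgraph. -/
def IsComponentOf (C G : Graph α β) : Prop :=
  Maximal (fun K : Graph α β => K ≤ G ∧ IsConnectedGraph K) C

/-- `C` is a cycle of length `n ≥ 1`, with vertices `v 0, …, v (n - 1)` and edges `e i` joining
`v i` to `v (i + 1)`, indices modulo `n`. A cycle of length `1` is a loop, a cycle of length `2`
is a pair of parallel edges. -/
def IsCycleGraph (C : Graph α β) (n : ℕ) : Prop :=
  1 ≤ n ∧ ∃ (v : ZMod n → α) (e : ZMod n → β),
    Function.Injective v ∧ Function.Injective e ∧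
    V(C) = Set.range v ∧ E(C) = Set.range e ∧ ∀ i, C.IsLink (e i) (v i) (v (i + 1))

/-- `P` is a path of length `n` (so with `n + 1` vertices and `n` edges). -/
def IsPathGraph (P : Graph α β) (n : ℕ) : Prop :=
  ∃ (v : Fin (n + 1) → α) (e : Fin n → β),
    Function.Injective v ∧ Function.Injective e ∧
    V(P) = Set.range v ∧ E(P) = Set.range e ∧ ∀ i, P.IsLink (e i) (v i.castSucc) (v i.succ)

/-- `F` is a forest: no subgraph of `F` is a cycle. -/
def IsForest (F : Graph α β) : Prop :=
  ∀ C ≤ F, ∀ n, ¬ IsCycleGraph C n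

/-- `v` is an isolated vertex of `G`: a vertex incident with no edge. -/
def IsIsolated (G : Graph α β) (v : α) : Prop :=
  v ∈ V(G) ∧ ∀ e, ¬ G.Inc e v

/-- `G` is bipartite: it has a proper colouring with two colours. -/
def IsBipartite (G : Graph α β) : Prop :=
  ∃ c : α → Bool, ∀ x y, G.Adj x y → c x ≠ c y

/-- The degree of `v` in `G`, where a loop at `v` counts twice. -/
noncomputable def degree (G : Graph α β) (v : α) : ℕ :=
  (G.incidenceSet v).ncard + (G.loopSet v).ncard

end Graphs

section DeltaMatroids

/-- A ground set together with a collection of sets, called feasible. -/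
@[ext]
structure SetSystem (β : Type*) where
  ground : Set β
  feasible : Set (Set β)

/-- Twisting: `(E, 𝓕) △ X = (E, {F △ X : F ∈ 𝓕})`. -/
def SetSystem.twist {β : Type*} (S : SetSystem β) (X : Set β) : SetSystem β where
  ground := S.ground
  feasible := (fun F => symmDiff F X) '' S.feasible

/-- The ground set of a matroid with the collection of its bases. -/
def basesOf {β : Type*} (N : Matroid β) : SetSystem β where
  ground := N.E
  feasible := {B | N.IsBase B}

/-- Delta-matroids. In the exchange axiom `y = x` is allowed, and then `{x, y} = {x}`. -/
structure DeltaMatroid (β : Type*) extends SetSystem β where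
  ground_finite : ground.Finite
  subset_ground : ∀ F ∈ feasible, F ⊆ ground
  feasible_nonempty : feasible.Nonempty
  exchange : ∀ X ∈ feasible, ∀ Y ∈ feasible, ∀ x ∈ symmDiff X Y,
    ∃ y ∈ symmDiff X Y, symmDiff X {x, y} ∈ feasible

namespace DeltaMatroid

variable {β : Type*}

/-- `(V₁, V₂)` is a separation of `M`: a partition of the ground set into two nonempty parts such
that the feasible sets of `M` are the unions of a feasible set of `M₁` and a feasible set of `M₂`
for some delta-matroids `M₁` on `V₁` and `M₂` on `V₂`. -/
def IsSeparation (M : DeltaMatroid β) (V₁ V₂ : Set β) : Prop :=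
  V₁.Nonempty ∧ V₂.Nonempty ∧ Disjoint V₁ V₂ ∧ V₁ ∪ V₂ = M.ground ∧
    ∃ M₁ M₂ : DeltaMatroid β, M₁.ground = V₁ ∧ M₂.ground = V₂ ∧
      M.feasible = {F | ∃ F₁ ∈ M₁.feasible, ∃ F₂ ∈ M₂.feasible, F = F₁ ∪ F₂}

/-- `M` is connected: it has no separation. -/
def IsConnected (M : DeltaMatroid β) : Prop :=
  ∀ V₁ V₂, ¬ M.IsSeparation V₁ V₂

/-- `M` is a twisted matroid: `M = (E, 𝓑 △ Y)` for a matroid on `E` with set of bases `𝓑` and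
some `Y ⊆ E`. -/
def IsTwistedMatroid (M : DeltaMatroid β) : Prop :=
  ∃ (N : Matroid β) (Y : Set β), Y ⊆ N.E ∧ M.toSetSystem = (basesOf N).twist Y

end DeltaMatroid

end DeltaMatroids

section Grafts

variable {α β γ δ : Type*}

/-- `H` is a `T`-spanning subgraph of `G`: it is a spanning subgraph, and each component `C` of `H`
has an odd number of vertices in `T`, or it has none and `G[V(C)]` is a component of `G`. -/
def IsTSpanning (G : Graph α β) (T : Set α) (H : Graph α β) : Prop :=
  H ≤ G ∧ V(H) = V(G) ∧ ∀ C, IsComponentOf C H →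
    Odd (V(C) ∩ T).ncard ∨ (V(C) ∩ T = ∅ ∧ IsComponentOf (G.induce V(C)) G)

/-- `𝓖(G, T)`: the ground set is `E(G)` and the feasible sets are the edge sets of the
`T`-spanning forests of `G`. -/
def graftSystem (G : Graph α β) (T : Set α) : SetSystem β where
  ground := E(G)
  feasible := {F | ∃ H : Graph α β, IsTSpanning G T H ∧ IsForest H ∧ E(H) = F}

/-- `(H, (B x)_{x ∈ V(H)})` is a cyclic decomposition of `(G, T)`. -/
structure IsCyclicDecomposition (G : Graph α β) (T : Set α) (H : Graph γ δ) (B : γ → Set α) :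
    Prop where
  vertexSet_finite : V(H).Finite
  edgeSet_finite : E(H).Finite
  bipartite : IsBipartite H
  degree_le : ∀ x ∈ V(H), degree H x ≤ 2
  iUnion_eq : ⋃ x ∈ V(H), B x = V(G)
  adj_mem : ∀ u v, G.Adj u v → ∃ x ∈ V(H), u ∈ B x ∧ v ∈ B x
  inter_subset : ∀ x ∈ V(H), ∀ y ∈ V(H), x ≠ y → B x ∩ B y ⊆ T
  ncard_inter : ∀ x ∈ V(H), ∀ y ∈ V(H), x ≠ y → (B x ∩ B y).ncard = {f | H.IsLink f x y}.ncard
  ncard_le : ∀ x ∈ V(H), (T ∩ B x).ncard ≤ 2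

/-- `(H, (B x)_{x ∈ V(H)})` is a nice cyclic decomposition of `(G, T)`. -/
structure IsNiceCyclicDecomposition (G : Graph α β) (T : Set α) (H : Graph γ δ) (B : γ → Set α) :
    Prop extends IsCyclicDecomposition G T H B where
  bag_connected : ∀ x ∈ V(H), IsConnectedGraph (G.induce (B x))
  isolated : ∀ x ∈ V(H), (B x ∩ T).ncard ≤ 1 → IsIsolated H x

end Grafts

end DeltaGraphic

/-!
For `T ≠ ∅` and `G` connected, the feasible sets of `𝓖(G, T)` are the spanning forests all of whose
components have an odd number of vertices in `T` (`mem_feasible_iff_of_joined`). A delta-matroid is a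
twisted matroid if and only if its feasible sets `F` are all equally far from some set `Z`, that is,
`|F ∆ Z|` is constant (`isTwistedMatroid_iff`). Both sides of the equivalence are compared with a third
condition, a good colouring (`IsGoodColouring`): the edges are coloured with two colours such that
every vertex outside `T` sees one colour only, and every component of a colour class has at most two
vertices in `T`.

* A good colouring balances the feasible sets (`IsGoodColouring.exists_balancedBy`). For a feasible
  set `F` with `k` components, a component with an odd number `m` of vertices in `T` splits into at
  least `(m + 1) / 2` pieces when only the edges of colour `c` are kept. This gives an upper bound on
  the number of edges of `F` of colour `c`. The bounds for the two colours add up to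
  `|V(G)| - k = |F|`, so both are attained, and the difference of the two numbers does not depend on
  `F`.
* Conversely, let `|F ∆ Z|` be constant (`BalancedBy.exists_isGoodColouring`). Take a spanning forest
  with exactly one vertex of `T` in each component and exchange one or two of its edges. A chord has
  the colour (membership in `Z`) of the cycle that it closes, an edge between two components that of
  the paths from its ends to the roots, and two edges that join a component to two different ones
  have different colours. If a vertex `v ∉ T` saw both colours, a part of the graft without vertices
  in `T` would hang at `v`, and `M` would have a separation (`Inseparable.no_pendant`).
* In a cyclic decomposition the bags of one colour in a bipartition of `H` are disjoint, so colouring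
  each edge like a bag that contains it is good (`IsCyclicDecomposition.exists_isGoodColouring`). If
  `|T| ≤ 2`, one colour suffices; for `T = ∅`, where every feasible set is a spanning tree, a single
  vertex is put into `T` first.
* If `|T| ≥ 3`, every component of a colour class of a good colouring has exactly two vertices in
  `T`, because `M` is connected. These pairs form two matchings on `T` whose union is a path or an even
  cycle (`exists_isAlternatingOrder`), along which the components of the colour classes are the bags
  of a nice cyclic decomposition (`IsGoodColouring.isNiceCyclicDecomposition`).
-/

namespace DeltaGraphic

open scoped Graph

/-! ### Walks and forests -/

section Walks

variable {α β : Type*} {G : Graph α β} {F F' : Set β} {T : Set α} {e f : β} {a b u v w : α}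

/-- `Joined G F u v`: there is a walk from `u` to `v` in `G` all of whose edges lie in `F`. Every
`u` is joined to itself, whether or not it is a vertex. -/
def Joined (G : Graph α β) (F : Set β) : α → α → Prop :=
  Relation.ReflTransGen fun a b => ∃ e ∈ F, G.IsLink e a b

lemma Joined.refl (u : α) : Joined G F u u := Relation.ReflTransGen.refl

lemma Joined.trans (h : Joined G F u v) (h' : Joined G F v w) : Joined G F u w :=
  Relation.ReflTransGen.trans h h'

lemma Joined.symm (h : Joined G F u v) : Joined G F v u := by
  induction h with
  | refl => exact Joined.refl _
  | tail _ hl ih =>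
    obtain ⟨e, he, hl⟩ := hl
    exact Relation.ReflTransGen.head ⟨e, he, hl.symm⟩ ih

lemma joined_comm : Joined G F u v ↔ Joined G F v u := ⟨Joined.symm, Joined.symm⟩

lemma Joined.of_link (he : e ∈ F) (h : G.IsLink e u v) : Joined G F u v :=
  Relation.ReflTransGen.single ⟨e, he, h⟩

lemma Joined.mono (hF : F ⊆ F') (h : Joined G F u v) : Joined G F' u v :=
  h.lift id fun _ _ ⟨e, he, h⟩ => ⟨e, hF he, h⟩

lemma Joined.mem_of_closed {S : Set α} (hS : ∀ e ∈ F, ∀ a b, G.IsLink e a b → a ∈ S → b ∈ S)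
    (h : Joined G F u v) (hu : u ∈ S) : v ∈ S := by
  induction h with
  | refl => exact hu
  | tail _ hl ih =>
    obtain ⟨e, he, hl⟩ := hl
    exact hS e he _ _ hl ih

lemma Joined.mem (h : Joined G F u v) (hu : u ∈ V(G)) : v ∈ V(G) :=
  h.mem_of_closed (fun _ _ _ _ hl _ => hl.right_mem) hu

lemma Joined.map {γ : Type*} {G' : Graph γ β} {F' : Set β} (ρ : α → γ)
    (hρ : ∀ e ∈ F, ∀ a b, G.IsLink e a b → Joined G' F' (ρ a) (ρ b))
    (h : Joined G F u v) : Joined G' F' (ρ u) (ρ v) := by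
  induction h with
  | refl => exact Joined.refl _
  | tail _ hl ih =>
    obtain ⟨e, he, hl⟩ := hl
    exact ih.trans (hρ e he _ _ hl)

/-- A walk that starts in a set closed under the edges of `F` uses only edges with an end in it. -/
lemma Joined.of_closed {S : Set α}
    (hS : ∀ e ∈ F, ∀ a b, G.IsLink e a b → a ∈ S → b ∈ S ∧ e ∈ F')
    (h : Joined G F u v) (hu : u ∈ S) : Joined G F' u v := by
  have : v ∈ S ∧ Joined G F' u v := by
    induction h with
    | refl => exact ⟨hu, (Joined.refl _)⟩
    | tail _ hl ih =>
      obtain ⟨e, he, hl⟩ := hl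
      obtain ⟨h1, h2⟩ := hS e he _ _ hl ih.1
      exact ⟨h1, ih.2.trans (.of_link h2 hl)⟩
  exact this.2

lemma joined_insert_iff (he : G.IsLink e a b) :
    Joined G (insert e F) u v ↔
      Joined G F u v ∨ (Joined G F u a ∧ Joined G F b v) ∨ (Joined G F u b ∧ Joined G F a v) := by
  constructor
  · intro h
    induction h with
    | refl => exact .inl (.refl _)
    | @tail x y _ hl ih =>
      obtain ⟨f, hf, hl⟩ := hl
      rcases Set.mem_insert_iff.1 hf with rfl | hf
      · obtain ⟨rfl, rfl⟩ | ⟨rfl, rfl⟩ := hl.eq_and_eq_or_eq_and_eq he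
        · rcases ih with ih | ⟨h1, h2⟩ | ⟨h1, h2⟩
          · exact .inr (.inl ⟨ih, Joined.refl _⟩)
          · exact .inr (.inl ⟨h1, Joined.refl _⟩)
          · exact .inl h1
        · rcases ih with ih | ⟨h1, h2⟩ | ⟨h1, h2⟩
          · exact .inr (.inr ⟨ih, Joined.refl _⟩)
          · exact .inl h1
          · exact .inr (.inr ⟨h1, Joined.refl _⟩)
      · have hl := Joined.of_link hf hl
        rcases ih with ih | ⟨h1, h2⟩ | ⟨h1, h2⟩
        · exact .inl (ih.trans hl)
        · exact .inr (.inl ⟨h1, h2.trans hl⟩)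
        · exact .inr (.inr ⟨h1, h2.trans hl⟩)
  · have hsub : F ⊆ insert e F := Set.subset_insert e F
    have hab : Joined G (insert e F) a b := .of_link (Set.mem_insert e F) he
    rintro (h | ⟨h1, h2⟩ | ⟨h1, h2⟩)
    · exact h.mono hsub
    · exact ((h1.mono hsub).trans hab).trans (h2.mono hsub)
    · exact ((h1.mono hsub).trans hab.symm).trans (h2.mono hsub)

lemma Joined.split (he : G.IsLink e a b) (h : Joined G F u v) :
    Joined G (F \ {e}) u v ∨ (Joined G (F \ {e}) u a ∧ Joined G (F \ {e}) b v) ∨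
      (Joined G (F \ {e}) u b ∧ Joined G (F \ {e}) a v) := by
  rw [← joined_insert_iff he]
  refine h.mono ?_
  simp

/-- `F` contains no cycle of `G`: no edge of `F` has its ends joined by the other edges of `F`. -/
def Acyclic (G : Graph α β) (F : Set β) : Prop :=
  ∀ e ∈ F, ∀ a b, G.IsLink e a b → ¬ Joined G (F \ {e}) a b

lemma Acyclic.mono (hF : Acyclic G F) (h : F' ⊆ F) : Acyclic G F' :=
  fun e he a b hl hj => hF e (h he) a b hl (hj.mono (Set.sdiff_subset_sdiff_left h))

lemma Acyclic.ne (hF : Acyclic G F) (he : e ∈ F) (h : G.IsLink e a b) : a ≠ b := by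
  rintro rfl
  exact hF e he _ _ h (.refl _)

lemma Acyclic.insert_edge (hF : Acyclic G F) (he : G.IsLink e a b) (hab : ¬ Joined G F a b) :
    Acyclic G (insert e F) := by
  intro f hf x y hl hj
  by_cases hfe : f = e
  · subst hfe
    have hj : Joined G F x y := hj.mono (by
      rintro g ⟨hg, hgf⟩
      exact (Set.mem_insert_iff.1 hg).resolve_left hgf)
    obtain ⟨rfl, rfl⟩ | ⟨rfl, rfl⟩ := hl.eq_and_eq_or_eq_and_eq he
    · exact hab hj
    · exact hab hj.symm
  · have hf : f ∈ F := (Set.mem_insert_iff.1 hf).resolve_left hfe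
    have hsub : F \ {f} ⊆ F := Set.sdiff_subset
    have hxy : Joined G F x y := .of_link hf hl
    rw [Set.insert_sdiff_of_notMem _ (by simpa using fun h => hfe h.symm),
      joined_insert_iff he] at hj
    rcases hj with hj | ⟨h1, h2⟩ | ⟨h1, h2⟩
    · exact hF f hf x y hl hj
    · exact hab (((h1.mono hsub).symm.trans hxy).trans (h2.mono hsub).symm)
    · exact hab (((h2.mono hsub).trans hxy.symm).trans (h1.mono hsub))

/-- The walk from `u` to `v ≠ u` has a last edge: an edge of `F` at `v` whose other end is joined
to `u` without it. -/
lemma Joined.exists_last (hfin : F.Finite) (h : Joined G F u v) (huv : u ≠ v) :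
    ∃ f ∈ F, ∃ w, G.IsLink f w v ∧ Joined G (F \ {f}) u w := by
  induction hn : F.ncard using Nat.strong_induction_on generalizing F with
  | _ n ih =>
    rcases Relation.ReflTransGen.cases_tail h with h' | ⟨w, hw, f, hf, hl⟩
    · exact absurd h'.symm huv
    · have key (h : Joined G (F \ {f}) u v) :
          ∃ f ∈ F, ∃ w, G.IsLink f w v ∧ Joined G (F \ {f}) u w := by
        obtain ⟨g, hg, x, hx, hj⟩ := ih _ (by
          rw [← hn]; exact Set.ncard_sdiff_singleton_lt_of_mem hf hfin) (hfin.subset Set.sdiff_subset)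
          h _root_.rfl
        exact ⟨g, hg.1, x, hx, hj.mono (Set.sdiff_subset_sdiff_left Set.sdiff_subset)⟩
      rcases Joined.split hl hw with h1 | ⟨h1, h2⟩ | ⟨h1, h2⟩
      · exact ⟨f, hf, w, hl, h1⟩
      · exact ⟨f, hf, w, hl, h1⟩
      · exact key h1

end Walks

/-! ### The feasible sets in terms of walks -/

section Translation

variable {α β : Type*} {G : Graph α β} {F : Set β} {T : Set α}

/-- A shortest walk repeats no vertex. -/
lemma exists_injOn_chain {r : α → α → Prop} {x y : α} (h : Relation.ReflTransGen r x y) :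
    ∃ (n : ℕ) (f : ℕ → α), f 0 = x ∧ f n = y ∧ (∀ i < n, r (f i) (f (i + 1))) ∧
      Set.InjOn f (Set.Iic n) := by
  have hex : ∃ (n : ℕ) (f : ℕ → α), f 0 = x ∧ f n = y ∧ ∀ i < n, r (f i) (f (i + 1)) := by
    induction h with
    | refl => exact ⟨0, fun _ => x, rfl, rfl, by simp⟩
    | @tail b c _ hbc ih =>
      obtain ⟨n, f, h0, hn, hf⟩ := ih
      refine ⟨n + 1, fun i => if i ≤ n then f i else c, by simp [h0], by simp, fun i hi => ?_⟩
      rcases Nat.lt_succ_iff_lt_or_eq.1 hi with hi | rfl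
      · simpa [hi.le, Nat.succ_le_of_lt hi] using hf i hi
      · simpa [hn] using hbc
  classical
  obtain ⟨f, h0, hn, hf⟩ := Nat.find_spec hex
  refine ⟨Nat.find hex, f, h0, hn, hf, ?_⟩
  set n := Nat.find hex with hndef
  have key : ∀ i j, i < j → j ≤ n → f i ≠ f j := by
    intro i j hij hj heq
    refine Nat.find_min hex (m := n - (j - i)) (by omega)
      ⟨fun k => if k ≤ i then f k else f (k + (j - i)), by simp [h0], ?_, fun k hk => ?_⟩
    · by_cases hle : n - (j - i) ≤ i
      · have h1 : n - (j - i) = i := by omega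
        have h2 : j = n := by omega
        simp only [hle, if_true]
        rw [h1, heq, h2, hn]
      · simp only [hle, if_false]
        rw [Nat.sub_add_cancel (by omega), hn]
    · by_cases h1 : k + 1 ≤ i
      · simpa [h1, (Nat.le_succ k).trans h1] using hf k (by omega)
      · by_cases h2 : k ≤ i
        · have h3 : k = i := by omega
          subst h3
          simp only [le_refl, if_true, h1, if_false, heq]
          rw [show k + 1 + (j - k) = j + 1 by omega]
          exact hf j (by omega)
        · simp only [h1, h2, if_false]
          rw [show k + 1 + (j - i) = k + (j - i) + 1 by omega]
          exact hf _ (by omega)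
  intro i hi j hj heq
  by_contra hne
  rcases lt_or_gt_of_ne hne with h | h
  · exact key i j h hj heq
  · exact key j i h hi heq.symm

lemma zmod_add_one_cases {n : ℕ} (i : ZMod (n + 1)) :
    (ZMod.val i < n ∧ ZMod.val (i + 1) = ZMod.val i + 1) ∨ (ZMod.val i = n ∧ i + 1 = 0) := by
  have hcast : ((ZMod.val i + 1 : ℕ) : ZMod (n + 1)) = i + 1 := by simp
  have hlt := ZMod.val_lt i
  by_cases hi : ZMod.val i < n
  · refine .inl ⟨hi, ?_⟩
    rw [← hcast, ZMod.val_cast_of_lt (by omega)]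
  · have hi' : ZMod.val i = n := by omega
    exact .inr ⟨hi', by rw [← hcast, hi', ZMod.natCast_self]⟩

lemma reflTransGen_adj_iff {x y : α} : Relation.ReflTransGen G.Adj x y ↔ Joined G E(G) x y := by
  have : G.Adj = fun a b => ∃ e ∈ E(G), G.IsLink e a b := by
    ext a b
    exact ⟨fun ⟨e, h⟩ => ⟨e, h.edge_mem, h⟩, fun ⟨e, _, h⟩ => ⟨e, h⟩⟩
  rw [this, Joined]

lemma joined_restrict_iff (hF : F ⊆ E(G)) {x y : α} :
    Joined (G.restrict F) E(G.restrict F) x y ↔ Joined G F x y := by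
  have : E(G.restrict F) = F := by simp [hF]
  rw [this]
  exact ⟨fun h => Joined.map (G := G.restrict F) id (fun e he a b hl => .of_link he hl.2) h,
    fun h => h.map id fun e he a b hl => .of_link he ⟨he, hl⟩⟩

lemma eq_restrict_of_spanning {H : Graph α β} (hle : H ≤ G) (hV : V(H) = V(G)) :
    H = G.restrict E(H) := by
  refine Graph.ext hV fun e x y => ?_
  exact ⟨fun h => ⟨h.edge_mem, h.mono hle⟩, fun h => (hle.isLink_iff h.1).2 h.2⟩

/-- The cycle subgraphs of `G` that have all their edges in `F` witness exactly the failures of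
`Acyclic G F`. -/
lemma isForest_restrict_iff : IsForest (G.restrict F) ↔ Acyclic G F := by
  constructor
  · intro h e he x y hl hj
    obtain ⟨n, f, h0, hn, hf, hinj⟩ := exists_injOn_chain hj
    have : Nonempty β := ⟨e⟩
    choose! d hd hdl using hf
    let v : ZMod (n + 1) → α := fun i => f (ZMod.val i)
    let ed : ZMod (n + 1) → β := fun i => if ZMod.val i < n then d (ZMod.val i) else e
    have hlt : ∀ i : ZMod (n + 1), ZMod.val i < n + 1 := fun i => ZMod.val_lt i
    have hv : Function.Injective v := fun i j hij =>
      ZMod.val_injective _ (hinj (Nat.lt_succ_iff.1 (hlt i)) (Nat.lt_succ_iff.1 (hlt j)) hij)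
    have hval : ∀ i : ZMod (n + 1), ZMod.val i < n → ZMod.val (i + 1) = ZMod.val i + 1 :=
      fun i hi => ((zmod_add_one_cases i).resolve_right fun h => hi.ne h.1).2
    have hlink : ∀ i, G.IsLink (ed i) (v i) (v (i + 1)) := by
      intro i
      by_cases hi : ZMod.val i < n
      · simp only [ed, v, hi, if_true, hval i hi]
        exact hdl _ hi
      · obtain ⟨hi', this⟩ := (zmod_add_one_cases i).resolve_left fun h => hi h.1
        simp only [ed, v, this, hi', ZMod.val_zero, lt_irrefl, if_false, hn, h0]
        exact hl.symm
    have hedF : ∀ i, ed i ∈ F := by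
      intro i
      by_cases hi : ZMod.val i < n
      · simpa [ed, hi] using (hd _ hi).1
      · simpa [ed, hi] using he
    have hed : Function.Injective ed := by
      intro i j hij
      by_cases hi : ZMod.val i < n <;> by_cases hj : ZMod.val j < n
      · have h1 := hlink i
        rw [hij] at h1
        rcases h1.eq_and_eq_or_eq_and_eq (hlink j) with ⟨h2, _⟩ | ⟨h2, h3⟩
        · exact hv h2
        · have h2 := congrArg ZMod.val (hv h2)
          have h3 := congrArg ZMod.val (hv h3)
          rw [hval _ hi] at h3
          rw [hval _ hj] at h2
          omega
      · simp only [ed, hi, hj, if_true, if_false] at hij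
        exact absurd hij (hd _ hi).2
      · simp only [ed, hi, hj, if_true, if_false] at hij
        exact absurd hij.symm (hd _ hj).2
      · exact ZMod.val_injective _ (by have := hlt i; have := hlt j; omega)
    refine h ((G.restrict (Set.range ed)).induce (Set.range v)) ⟨?_, ?_⟩ (n + 1)
      ⟨by omega, v, ed, hv, hed, rfl, ?_, fun i => ⟨⟨⟨i, rfl⟩, hlink i⟩, ⟨i, rfl⟩, ⟨i + 1, rfl⟩⟩⟩
    · rintro _ ⟨i, rfl⟩
      exact (hlink i).left_mem
    · rintro g a b ⟨⟨⟨i, rfl⟩, h1⟩, -⟩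
      exact ⟨hedF i, h1⟩
    · ext g
      rw [Graph.edge_mem_iff_exists_isLink]
      constructor
      · rintro ⟨a, b, ⟨h1, -⟩, -⟩
        exact h1
      · rintro ⟨i, rfl⟩
        exact ⟨_, _, ⟨⟨i, rfl⟩, hlink i⟩, ⟨i, rfl⟩, ⟨i + 1, rfl⟩⟩
  · rintro h C hC n ⟨hn, v, e, hv, he, -, hE, hl⟩
    have hlG : ∀ i, e i ∈ F ∧ G.IsLink (e i) (v i) (v (i + 1)) := fun i => (hl i).mono hC
    refine h (e 0) (hlG 0).1 _ _ (hlG 0).2 ?_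
    have key : ∀ i : ℕ, i + 1 ≤ n → Joined G (F \ {e 0}) (v (0 + 1)) (v ((i + 1 : ℕ) : ZMod n)) := by
      intro i hi
      induction i with
      | zero => simpa using Joined.refl _
      | succ i ih =>
        refine (ih (by omega)).trans (.of_link ⟨(hlG ((i + 1 : ℕ) : ZMod n)).1, fun h0 => ?_⟩ ?_)
        · have h1 := he h0
          rw [ZMod.natCast_eq_zero_iff] at h1
          have := Nat.le_of_dvd (by omega) h1
          omega
        · have := (hlG ((i + 1 : ℕ) : ZMod n)).2
          push_cast at this ⊢
          exact this
    have := key (n - 1) (by omega)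
    rw [Nat.sub_add_cancel hn, ZMod.natCast_self] at this
    exact this.symm

lemma isComponentOf_iff {C : Graph α β} :
    IsComponentOf C G ↔ ∃ u ∈ V(G), C = G.induce {v | Joined G E(G) u v} := by
  have hle : ∀ u ∈ V(G), G.induce {v | Joined G E(G) u v} ≤ G := fun u hu =>
    Graph.induce_le fun v hv => hv.mem hu
  have hcon : ∀ u ∈ V(G), IsConnectedGraph (G.induce {v | Joined G E(G) u v}) := by
    refine fun u hu => ⟨⟨u, Joined.refl u⟩, fun x hx y hy => ?_⟩
    have hxy : Joined G E(G) x y := hx.symm.trans hy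
    have := hxy.of_closed (G := G) (S := {v | Joined G E(G) u v})
      (F' := E(G.induce {v | Joined G E(G) u v})) (fun e he a b hl ha => by
        have hb : Joined G E(G) u b := Joined.trans ha (.of_link he hl)
        refine ⟨hb, ?_⟩
        rw [Graph.edge_mem_iff_exists_isLink]
        exact ⟨a, b, hl, ha, hb⟩) hx
    rw [reflTransGen_adj_iff]
    exact this.map id fun e he a b hl => .of_link he (((hle u hu).isLink_iff he).2 hl)
  have hsub : ∀ K : Graph α β, K ≤ G → IsConnectedGraph K → ∀ u ∈ V(K),
      K ≤ G.induce {v | Joined G E(G) u v} := by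
    intro K hK hKc u hu
    have hV : ∀ v ∈ V(K), Joined G E(G) u v := fun v hv =>
      (reflTransGen_adj_iff.1 (hKc.2 u hu v hv)).map id fun e he a b hl =>
        .of_link (hl.mono hK).edge_mem (hl.mono hK)
    exact ⟨hV, fun e x y hl => ⟨hl.mono hK, hV _ hl.left_mem, hV _ hl.right_mem⟩⟩
  constructor
  · rintro ⟨⟨hC, hCc⟩, hmax⟩
    obtain ⟨u, hu⟩ := hCc.1
    have huG := hC.vertexSet_mono hu
    exact ⟨u, huG, le_antisymm (hsub C hC hCc u hu)
      (hmax ⟨hle u huG, hcon u huG⟩ (hsub C hC hCc u hu))⟩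
  · rintro ⟨u, hu, rfl⟩
    refine ⟨⟨hle u hu, hcon u hu⟩, fun K hK hCK => hsub K hK.1 hK.2 u ?_⟩
    exact hCK.vertexSet_mono (Joined.refl u)

/-- The class of `u` under `F` is admissible for `T`: it has an odd number of vertices in `T`, or
it has none and is a whole component of `G`. -/
def IsAdmissibleClass (G : Graph α β) (T : Set α) (F : Set β) (u : α) : Prop :=
  Odd {t | Joined G F u t ∧ t ∈ T}.ncard ∨
    ({t | Joined G F u t ∧ t ∈ T} = ∅ ∧ ∀ v, Joined G E(G) u v → Joined G F u v)

/-- The feasible sets of `𝓖(G, T)` in terms of walks. -/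
lemma mem_feasible_iff : F ∈ (graftSystem G T).feasible ↔
    F ⊆ E(G) ∧ Acyclic G F ∧ ∀ u ∈ V(G), IsAdmissibleClass G T F u := by
  have key : F ⊆ E(G) → (IsTSpanning G T (G.restrict F) ↔ ∀ u ∈ V(G), IsAdmissibleClass G T F u) := by
    intro hF
    have hcl : ∀ u, {v | Joined (G.restrict F) E(G.restrict F) u v} = {v | Joined G F u v} :=
      fun u => Set.ext fun v => joined_restrict_iff hF
    have hcomp : ∀ u ∈ V(G), IsComponentOf (G.induce {v | Joined G F u v}) G ↔
        ∀ v, Joined G E(G) u v → Joined G F u v := by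
      intro u hu
      rw [isComponentOf_iff]
      constructor
      · rintro ⟨w, hw, heq⟩ v hv
        have hVeq : {v | Joined G F u v} = {v | Joined G E(G) w v} := congrArg Graph.vertexSet heq
        have h1 : u ∈ {v | Joined G E(G) w v} := hVeq ▸ Joined.refl u
        have h2 : v ∈ {v | Joined G E(G) w v} := Joined.trans h1 hv
        rw [← hVeq] at h2
        exact h2
      · intro h
        refine ⟨u, hu, congrArg _ (Set.ext fun v => ⟨fun hv => hv.mono hF, h v⟩)⟩
    refine ⟨fun ⟨_, _, h⟩ u hu => ?_, fun h => ⟨Graph.restrict_le, rfl, fun C hC => ?_⟩⟩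
    · have := h _ (isComponentOf_iff.2 ⟨u, hu, rfl⟩)
      rw [Graph.vertexSet_induce, hcl, hcomp u hu] at this
      exact this
    · obtain ⟨u, hu, rfl⟩ := isComponentOf_iff.1 hC
      have := h u hu
      rw [Graph.vertexSet_induce, hcl, hcomp u hu]
      exact this
  constructor
  · rintro ⟨H, hT, hfor, rfl⟩
    have hE := hT.1.edgeSet_mono
    have hH := eq_restrict_of_spanning hT.1 hT.2.1
    rw [hH] at hT hfor
    exact ⟨hE, isForest_restrict_iff.1 hfor, (key hE).1 hT⟩
  · rintro ⟨hF, hac, hcl⟩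
    exact ⟨G.restrict F, (key hF).2 hcl, isForest_restrict_iff.2 hac, by simp [hF]⟩

end Translation

/-! ### Delta-matroids with a separation and twisted matroids -/

section Matroids

variable {β : Type*} {S : SetSystem β} {X V₁ V₂ : Set β}

/-- The restriction to `V₁` of a delta-matroid whose feasible sets can be mixed along the partition
`V₁, V₂` of the ground set. -/
def DeltaMatroid.part (M : DeltaMatroid β) (V₁ V₂ : Set β) (hdisj : Disjoint V₁ V₂)
    (hU : V₁ ∪ V₂ = M.ground)
    (hmix : ∀ A ∈ M.feasible, ∀ B ∈ M.feasible, A ∩ V₁ ∪ B ∩ V₂ ∈ M.feasible) :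
    DeltaMatroid β where
  ground := V₁
  feasible := (fun A => A ∩ V₁) '' M.feasible
  ground_finite := M.ground_finite.subset (hU ▸ Set.subset_union_left)
  subset_ground := by
    rintro _ ⟨A, -, rfl⟩
    exact Set.inter_subset_right
  feasible_nonempty := M.feasible_nonempty.image _
  exchange := by
    rintro _ ⟨A, hA, rfl⟩ _ ⟨B, hB, rfl⟩ x hx
    have hdis : ∀ z, z ∈ V₁ → z ∉ V₂ := fun z h h' => Set.disjoint_left.1 hdisj h h'
    have hAU : ∀ z ∈ A, z ∈ V₁ ∨ z ∈ V₂ := fun z hz => by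
      have := M.subset_ground A hA hz
      rw [← hU] at this
      exact this
    have heq : symmDiff A (B ∩ V₁ ∪ A ∩ V₂) = symmDiff (A ∩ V₁) (B ∩ V₁) := by
      ext z
      have := hdis z
      have := hAU z
      simp only [Set.mem_symmDiff, Set.mem_union, Set.mem_inter_iff]
      tauto
    obtain ⟨y, hy, hxy⟩ := M.exchange A hA _ (hmix B hB A hA) x (heq ▸ hx)
    rw [heq] at hy
    have hmem : ∀ z ∈ symmDiff (A ∩ V₁) (B ∩ V₁), z ∈ V₁ := by
      rintro z (h | h)
      · exact h.1.2
      · exact h.1.2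
    refine ⟨y, hy, _, hxy, ?_⟩
    have hsub : ({x, y} : Set β) ⊆ V₁ := Set.pair_subset (hmem x hx) (hmem y hy)
    ext z
    have := @hsub z
    simp only [Set.mem_symmDiff, Set.mem_inter_iff]
    tauto

/-- A connected delta-matroid has two feasible sets that cannot be mixed along a given partition of
the ground set. -/
lemma DeltaMatroid.IsConnected.exists_not_mix {M : DeltaMatroid β} (hM : M.IsConnected)
    (h₁ : V₁.Nonempty) (h₂ : V₂.Nonempty) (hdisj : Disjoint V₁ V₂) (hU : V₁ ∪ V₂ = M.ground) :
    ∃ A ∈ M.feasible, ∃ B ∈ M.feasible, A ∩ V₁ ∪ B ∩ V₂ ∉ M.feasible := by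
  by_contra! hmix
  refine hM V₁ V₂ ⟨h₁, h₂, hdisj, hU, M.part V₁ V₂ hdisj hU hmix,
    M.part V₂ V₁ hdisj.symm (by rw [Set.union_comm, hU])
      (fun A hA B hB => by rw [Set.union_comm]; exact hmix B hB A hA), rfl, rfl, ?_⟩
  ext F
  constructor
  · intro hF
    refine ⟨_, ⟨F, hF, rfl⟩, _, ⟨F, hF, rfl⟩, ?_⟩
    change F = F ∩ V₁ ∪ F ∩ V₂
    rw [← Set.inter_union_distrib_left, hU, Set.inter_eq_left.2 (M.subset_ground F hF)]
  · rintro ⟨_, ⟨A, hA, rfl⟩, _, ⟨B, hB, rfl⟩, rfl⟩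
    exact hmix A hA B hB

/-- The preceding lemma for a set system that a twist turns into a connected delta-matroid. -/
lemma exists_not_mix_of_twist {M : DeltaMatroid β} (hM : M.IsConnected)
    (hMS : M.toSetSystem = S.twist X)
    (h₁ : V₁.Nonempty) (h₂ : V₂.Nonempty) (hdisj : Disjoint V₁ V₂) (hU : V₁ ∪ V₂ = S.ground)
    (hX : X ⊆ S.ground) :
    ∃ A ∈ S.feasible, ∃ B ∈ S.feasible, A ∩ V₁ ∪ B ∩ V₂ ∉ S.feasible := by
  have hg : M.ground = S.ground := (congrArg SetSystem.ground hMS :)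
  have hf : M.feasible = (fun F => symmDiff F X) '' S.feasible :=
    (congrArg SetSystem.feasible hMS :)
  obtain ⟨_, hA, _, hB, h⟩ := hM.exists_not_mix h₁ h₂ hdisj (hU.trans hg.symm)
  rw [hf] at hA hB h
  obtain ⟨A, hA, rfl⟩ := hA
  obtain ⟨B, hB, rfl⟩ := hB
  refine ⟨A, hA, B, hB, fun hAB => h ⟨_, hAB, ?_⟩⟩
  ext z
  have h3 : z ∈ V₁ → z ∉ V₂ := fun h h' => Set.disjoint_left.1 hdisj h h'
  have h4 : z ∈ X → z ∈ V₁ ∨ z ∈ V₂ := fun hz => by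
    have := hX hz
    rw [← hU] at this
    exact this
  simp only [Set.mem_symmDiff, Set.mem_union, Set.mem_inter_iff]
  tauto

/-- A delta-matroid is a twisted matroid if and only if a twist makes all its feasible sets
equally large. -/
lemma isTwistedMatroid_iff {M : DeltaMatroid β} (hMS : M.toSetSystem = S.twist X)
    (hX : X ⊆ S.ground) : M.IsTwistedMatroid ↔
      ∃ Z ⊆ S.ground, ∃ n, ∀ F ∈ S.feasible, (symmDiff F Z).ncard = n := by
  have hg : M.ground = S.ground := (congrArg SetSystem.ground hMS :)
  have hf : M.feasible = (fun F => symmDiff F X) '' S.feasible :=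
    (congrArg SetSystem.feasible hMS :)
  constructor
  · rintro ⟨N, Y, hY, h⟩
    have hg' : S.ground = N.E := hg.symm.trans (congrArg SetSystem.ground h :)
    have hf' : M.feasible = (fun F => symmDiff F Y) '' {B | N.IsBase B} :=
      congrArg SetSystem.feasible h
    obtain ⟨B₀, hB₀⟩ := N.exists_isBase
    refine ⟨symmDiff X Y, ?_, B₀.ncard, fun F hF => ?_⟩
    · exact Set.symmDiff_subset_union.trans (Set.union_subset hX (hg' ▸ hY))
    · have h1 : symmDiff F X ∈ M.feasible := hf ▸ ⟨F, hF, rfl⟩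
      rw [hf'] at h1
      obtain ⟨B, hB, hBF⟩ := h1
      have h2 : symmDiff F (symmDiff X Y) = B := by
        rw [← symmDiff_assoc, ← hBF]
        simp
      rw [h2]
      exact Matroid.IsBase.ncard_eq_ncard_of_isBase hB hB₀
  · rintro ⟨Z, hZ, n, hn⟩
    set Y := symmDiff X Z with hYdef
    have hYE : Y ⊆ M.ground := hg ▸ Set.symmDiff_subset_union.trans (Set.union_subset hX hZ)
    have hcard : ∀ A ∈ M.feasible, (symmDiff A Y).ncard = n := by
      rw [hf]
      rintro _ ⟨F, hF, rfl⟩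
      have : symmDiff (symmDiff F X) Y = symmDiff F Z := by
        rw [hYdef, symmDiff_assoc, symmDiff_symmDiff_cancel_left]
      rw [this, hn F hF]
    have hsub : ∀ B, symmDiff B Y ∈ M.feasible → B ⊆ M.ground := by
      intro B hB
      have : B = symmDiff (symmDiff B Y) Y := by simp
      rw [this]
      exact Set.symmDiff_subset_union.trans (Set.union_subset (M.subset_ground _ hB) hYE)
    have hcard' : ∀ B, symmDiff B Y ∈ M.feasible → B.ncard = n := by
      intro B hB
      simpa using hcard _ hB
    refine ⟨Matroid.ofIsBaseOfFinite M.ground_finite (fun B => symmDiff B Y ∈ M.feasible) ?_ ?_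
      hsub, Y, hYE, ?_⟩
    · obtain ⟨A, hA⟩ := M.feasible_nonempty
      exact ⟨symmDiff A Y, by simpa using hA⟩
    · intro A B hA hB a ha
      have heq : symmDiff (symmDiff A Y) (symmDiff B Y) = symmDiff A B := by
        rw [symmDiff_symmDiff_symmDiff_comm, symmDiff_self]
        simp
      obtain ⟨b, hb, hab⟩ := M.exchange _ hA _ hB a (heq ▸ Or.inl ha)
      rw [heq] at hb
      have h1 : symmDiff (symmDiff A Y) {a, b} = symmDiff (symmDiff A {a, b}) Y :=
        symmDiff_right_comm _ _ _
      rw [h1] at hab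
      have hc := hcard' _ hab
      have hAfin : A.Finite := M.ground_finite.subset (hsub A hA)
      have hbA : b ∉ A := by
        intro hbA
        -- removing `a`, or `a` and `b`, would change the size
        have h2 : symmDiff A {a, b} ⊂ A := by
          refine ⟨?_, fun h => ?_⟩
          · rintro z (h | ⟨rfl | rfl, h⟩)
            · exact h.1
            · exact absurd ha.1 h
            · exact absurd hbA h
          · rcases h ha.1 with h | h
            · exact h.2 (Set.mem_insert _ _)
            · exact h.2 ha.1
        have h3 := Set.ncard_lt_ncard h2 hAfin
        rw [hc, hcard' A hA] at h3
        exact lt_irrefl _ h3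
      have hbB : b ∈ B := by
        rcases hb with hb | hb
        · exact absurd hb.1 hbA
        · exact hb.1
      refine ⟨b, ⟨hbB, hbA⟩, ?_⟩
      have hab' : a ≠ b := fun h => hbA (h ▸ ha.1)
      have : insert b (A \ {a}) = symmDiff A {a, b} := by
        ext z
        by_cases hza : z = a
        · subst hza
          simp [Set.mem_symmDiff, hab', ha.1]
        · by_cases hzb : z = b
          · subst hzb
            simp [Set.mem_symmDiff, hbA]
          · simp [Set.mem_symmDiff, hza, hzb]
      rw [this]
      exact hab
    · ext A
      · rfl
      · change A ∈ M.feasible ↔ A ∈ (fun F => symmDiff F Y) '' {B | symmDiff B Y ∈ M.feasible}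
        constructor
        · intro hA
          exact ⟨symmDiff A Y, by simpa using hA, by simp⟩
        · rintro ⟨B, hB, rfl⟩
          exact hB

end Matroids

/-! ### Connectivity of the graft -/

section Connectivity

variable {α β : Type*} {G : Graph α β} {F F' : Set β} {T : Set α} {e : β} {a b u v w : α}

/-- `𝓖(G, T)` has no separation: along no partition of `E(G)` into nonempty sets can the feasible
sets be mixed. -/
def Inseparable (G : Graph α β) (T : Set α) : Prop :=
  ∀ V₁ V₂ : Set β, V₁.Nonempty → V₂.Nonempty → Disjoint V₁ V₂ → V₁ ∪ V₂ = E(G) →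
    ∃ A ∈ (graftSystem G T).feasible, ∃ B ∈ (graftSystem G T).feasible,
      A ∩ V₁ ∪ B ∩ V₂ ∉ (graftSystem G T).feasible

/-- Inside a set closed under adjacency only the edges that have an end there matter. -/
lemma joined_congr_of_closed {S : Set α} (hS : ∀ e a b, G.IsLink e a b → a ∈ S → b ∈ S)
    (hF : ∀ e a b, G.IsLink e a b → a ∈ S → (e ∈ F ↔ e ∈ F')) (hu : u ∈ S) :
    Joined G F u v ↔ Joined G F' u v :=
  ⟨fun h => h.of_closed (fun e he a b hl ha => ⟨hS e a b hl ha, (hF e a b hl ha).1 he⟩) hu,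
    fun h => h.of_closed (fun e he a b hl ha => ⟨hS e a b hl ha, (hF e a b hl ha).2 he⟩) hu⟩

lemma Inseparable.joined (hG : ∀ v, ¬ IsIsolated G v) (h : Inseparable G T) (hu : u ∈ V(G))
    (hv : v ∈ V(G)) : Joined G E(G) u v := by
  by_contra huv
  have hedge : ∀ x ∈ V(G), ∃ e y, G.IsLink e x y := fun x hx => by
    by_contra! hcon
    exact hG x ⟨hx, fun e ⟨y, hy⟩ => hcon e y hy⟩
  set S : Set α := {w | Joined G E(G) u w} with hSdef
  have hS : ∀ e a b, G.IsLink e a b → a ∈ S → b ∈ S := fun e a b hl ha =>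
    Joined.trans ha (.of_link hl.edge_mem hl)
  have hS' : ∀ e a b, G.IsLink e a b → a ∈ Sᶜ → b ∈ Sᶜ := fun e a b hl ha hb =>
    ha (hS e b a hl.symm hb)
  set V₁ : Set β := {e | ∃ a ∈ S, ∃ b, G.IsLink e a b} with hV₁
  have hmem : ∀ e a b, G.IsLink e a b → (e ∈ V₁ ↔ a ∈ S) := by
    intro e a b hl
    refine ⟨fun ⟨c, hc, d, hl'⟩ => ?_, fun ha => ⟨a, ha, b, hl⟩⟩
    obtain ⟨rfl, rfl⟩ | ⟨rfl, rfl⟩ := hl.eq_and_eq_or_eq_and_eq hl'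
    · exact hc
    · exact hS _ _ _ hl' hc
  have hV₁E : V₁ ⊆ E(G) := fun e ⟨_, _, _, hl⟩ => hl.edge_mem
  obtain ⟨e₁, y₁, hl₁⟩ := hedge u hu
  obtain ⟨e₂, y₂, hl₂⟩ := hedge v hv
  obtain ⟨A, hA, B, hB, hAB⟩ := h V₁ (E(G) \ V₁) ⟨e₁, (hmem _ _ _ hl₁).2 (Joined.refl u)⟩
    ⟨e₂, hl₂.edge_mem, fun h => huv ((hmem _ _ _ hl₂).1 h)⟩ Set.disjoint_sdiff_right
    (Set.union_sdiff_cancel hV₁E)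
  rw [mem_feasible_iff] at hA hB hAB
  obtain ⟨hAE, hAac, hAcl⟩ := hA
  obtain ⟨hBE, hBac, hBcl⟩ := hB
  set F : Set β := A ∩ V₁ ∪ B ∩ (E(G) \ V₁) with hF
  have hFA : ∀ e a b, G.IsLink e a b → a ∈ S → (e ∈ F ↔ e ∈ A) := by
    intro e a b hl ha
    have := (hmem e a b hl).2 ha
    simp [hF, this]
  have hFB : ∀ e a b, G.IsLink e a b → a ∈ Sᶜ → (e ∈ F ↔ e ∈ B) := by
    intro e a b hl ha
    have : e ∉ V₁ := fun h => ha ((hmem e a b hl).1 h)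
    simp [hF, this, hl.edge_mem]
  refine hAB ⟨?_, ?_, fun x hx => ?_⟩
  · rintro e (he | he)
    · exact hAE he.1
    · exact hBE he.1
  · intro e he a b hl hj
    by_cases ha : a ∈ S
    · refine hAac e ((hFA e a b hl ha).1 he) a b hl ((joined_congr_of_closed hS ?_ ha).1 hj)
      intro f c d hl' hc
      simp [hFA f c d hl' hc]
    · refine hBac e ((hFB e a b hl ha).1 he) a b hl ((joined_congr_of_closed hS' ?_ ha).1 hj)
      intro f c d hl' hc
      simp [hFB f c d hl' hc]
  · by_cases hxS : x ∈ S
    · have := hAcl x hx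
      simp only [IsAdmissibleClass] at this ⊢
      simpa only [fun w => (joined_congr_of_closed (v := w) hS hFA hxS)] using this
    · have := hBcl x hx
      simp only [IsAdmissibleClass] at this ⊢
      simpa only [fun w => (joined_congr_of_closed (v := w) hS' hFB hxS)] using this

/-- In a connected graph and for `T ≠ ∅` the feasible sets are the spanning forests all of whose
components have an odd number of vertices in `T`. -/
lemma mem_feasible_iff_of_joined (hcon : ∀ u ∈ V(G), ∀ v ∈ V(G), Joined G E(G) u v)
    (hT : T ⊆ V(G)) (hne : T.Nonempty) : F ∈ (graftSystem G T).feasible ↔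
      F ⊆ E(G) ∧ Acyclic G F ∧ ∀ u ∈ V(G), Odd {t | Joined G F u t ∧ t ∈ T}.ncard := by
  rw [mem_feasible_iff]
  refine and_congr_right fun _ => and_congr_right fun _ => forall₂_congr fun u hu => ?_
  refine or_iff_left fun ⟨h0, hall⟩ => ?_
  obtain ⟨t, ht⟩ := hne
  have : t ∈ {t | Joined G F u t ∧ t ∈ T} := ⟨hall t (hcon u hu t (hT ht)), ht⟩
  rw [h0] at this
  exact this

lemma Inseparable.eq_of_isLink_self (h : Inseparable G T) (hl : G.IsLink e a a) {f : β}
    (hf : f ∈ E(G)) : f = e := by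
  by_contra hfe
  obtain ⟨A, hA, B, hB, hAB⟩ := h {e} (E(G) \ {e}) ⟨e, rfl⟩ ⟨f, hf, hfe⟩
    Set.disjoint_sdiff_right (Set.union_sdiff_cancel (Set.singleton_subset_iff.2 hl.edge_mem))
  refine hAB ?_
  have heA : e ∉ A := fun he => (mem_feasible_iff.1 hA).2.1.ne he hl rfl
  have heB : e ∉ B := fun he => (mem_feasible_iff.1 hB).2.1.ne he hl rfl
  have : A ∩ {e} ∪ B ∩ (E(G) \ {e}) = B := by
    ext x
    have h1 : x = e → x ∉ A := fun h => h ▸ heA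
    have h2 : x = e → x ∉ B := fun h => h ▸ heB
    have h3 : x ∈ B → x ∈ E(G) := fun h => (mem_feasible_iff.1 hB).1 h
    simp only [Set.mem_union, Set.mem_inter_iff, Set.mem_sdiff, Set.mem_singleton_iff]
    tauto
  rwa [this]

/-- No part `W` of an inseparable graft that avoids `T` hangs at a single vertex `v`. For a feasible
`A`, the edges of `A` that meet `W` form a spanning tree of this part, whatever the rest of `A` is. -/
lemma Inseparable.no_pendant (hcon : ∀ u ∈ V(G), ∀ v ∈ V(G), Joined G E(G) u v)
    (hT : T ⊆ V(G)) (hne : T.Nonempty) (h : Inseparable G T) {W : Set α} (hvW : v ∉ W)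
    (hWT : ∀ w ∈ W, w ∉ T) (hW : ∀ e a b, G.IsLink e a b → a ∈ W → b ∈ W ∨ b = v)
    {e₁ e₂ : β} {a₁ b₁ a₂ b₂ : α} (hl₁ : G.IsLink e₁ a₁ b₁) (ha₁ : a₁ ∈ W)
    (hl₂ : G.IsLink e₂ a₂ b₂) (ha₂ : a₂ ∉ W) (hb₂ : b₂ ∉ W) : False := by
  classical
  set V₁ : Set β := {e | ∃ a ∈ W, ∃ b, G.IsLink e a b} with hV₁
  have hV₁E : V₁ ⊆ E(G) := fun e ⟨_, _, _, hl⟩ => hl.edge_mem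
  have hin : ∀ e ∈ V₁, ∀ a b, G.IsLink e a b → (a ∈ W ∨ a = v) ∧ (b ∈ W ∨ b = v) := by
    rintro e ⟨c, hc, d, hl'⟩ a b hl
    obtain ⟨rfl, rfl⟩ | ⟨rfl, rfl⟩ := hl.eq_and_eq_or_eq_and_eq hl'
    · exact ⟨.inl hc, hW _ _ _ hl hc⟩
    · exact ⟨hW _ _ _ hl' hc, .inl hc⟩
  have hout : ∀ e, e ∉ V₁ → ∀ a b, G.IsLink e a b → a ∉ W ∧ b ∉ W := fun e he a b hl =>
    ⟨fun ha => he ⟨a, ha, b, hl⟩, fun hb => he ⟨b, hb, a, hl.symm⟩⟩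
  obtain ⟨A, hA, B, hB, hAB⟩ := h V₁ (E(G) \ V₁) ⟨e₁, a₁, ha₁, b₁, hl₁⟩
    ⟨e₂, hl₂.edge_mem, fun ⟨c, hc, d, hl'⟩ => by
      obtain ⟨rfl, rfl⟩ | ⟨rfl, rfl⟩ := hl₂.eq_and_eq_or_eq_and_eq hl'
      · exact ha₂ hc
      · exact hb₂ hc⟩ Set.disjoint_sdiff_right (Set.union_sdiff_cancel hV₁E)
  rw [mem_feasible_iff_of_joined hcon hT hne] at hA hB hAB
  obtain ⟨hAE, hAac, hAcl⟩ := hA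
  obtain ⟨hBE, hBac, hBcl⟩ := hB
  set F : Set β := A ∩ V₁ ∪ B ∩ (E(G) \ V₁) with hF
  -- the two retractions that collapse the outside of `W`, and `W`, to `v`
  let ρ : α → α := fun z => if z ∈ W then z else v
  let σ : α → α := fun z => if z ∈ W then v else z
  have hρ : ∀ z, z ∈ W ∨ z = v → ρ z = z := by
    rintro z (hz | rfl)
    · simp [ρ, hz]
    · simp [ρ]
  have hρ' : ∀ z, z ∉ W → ρ z = v := fun z hz => by simp [ρ, hz]
  have hσ : ∀ z, z ∉ W → σ z = z := fun z hz => by simp [σ, hz]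
  have hσ' : ∀ z, z ∈ W ∨ z = v → σ z = v := by
    rintro z (hz | rfl)
    · simp [σ, hz]
    · simp [σ]
  have mapρ : ∀ {P Q : Set β} {x y : α}, (∀ e ∈ P, e ∈ V₁ → e ∈ Q) → Joined G P x y →
      Joined G Q (ρ x) (ρ y) := by
    intro P Q x y hPQ hj
    refine hj.map ρ fun e he a b hl => ?_
    by_cases heV : e ∈ V₁
    · obtain ⟨ha, hb⟩ := hin e heV a b hl
      rw [hρ a ha, hρ b hb]
      exact .of_link (hPQ e he heV) hl
    · obtain ⟨ha, hb⟩ := hout e heV a b hl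
      rw [hρ' a ha, hρ' b hb]
      exact .refl _
  have mapσ : ∀ {P Q : Set β} {x y : α}, (∀ e ∈ P, e ∉ V₁ → e ∈ Q) → Joined G P x y →
      Joined G Q (σ x) (σ y) := by
    intro P Q x y hPQ hj
    refine hj.map σ fun e he a b hl => ?_
    by_cases heV : e ∈ V₁
    · obtain ⟨ha, hb⟩ := hin e heV a b hl
      rw [hσ' a ha, hσ' b hb]
      exact .refl _
    · obtain ⟨ha, hb⟩ := hout e heV a b hl
      rw [hσ a ha, hσ b hb]
      exact .of_link (hPQ e he heV) hl
  have hFin : ∀ e, e ∈ V₁ → e ∈ F → e ∈ A := by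
    rintro e he (h | h)
    · exact h.1
    · exact absurd he h.2.2
  have hFout : ∀ e, e ∉ V₁ → e ∈ F → e ∈ B := by
    rintro e he (h | h)
    · exact absurd h.2 he
    · exact h.1
  have hWv : ∀ w ∈ W, w ∈ V(G) → Joined G F w v := by
    intro w hw hwV
    obtain ⟨t, ht, htT⟩ : {t | Joined G A w t ∧ t ∈ T}.Nonempty :=
      Set.nonempty_of_ncard_ne_zero (hAcl w hwV).pos.ne'
    have := mapρ (Q := F) (fun e he heV => .inl ⟨he, heV⟩) ht
    rwa [hρ w (.inl hw), hρ' t (fun h => hWT t h htT)] at this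
  refine hAB ⟨?_, ?_, fun x hx => ?_⟩
  · rintro e (he | he)
    · exact hAE he.1
    · exact hBE he.1
  · intro e he a b hl hj
    by_cases heV : e ∈ V₁
    · obtain ⟨ha, hb⟩ := hin e heV a b hl
      have := mapρ (Q := A \ {e}) (fun f hf hfV => ⟨hFin f hfV hf.1, hf.2⟩) hj
      rw [hρ a ha, hρ b hb] at this
      exact hAac e (hFin e heV he) a b hl this
    · obtain ⟨ha, hb⟩ := hout e heV a b hl
      have := mapσ (Q := B \ {e}) (fun f hf hfV => ⟨hFout f hfV hf.1, hf.2⟩) hj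
      rw [hσ a ha, hσ b hb] at this
      exact hBac e (hFout e heV he) a b hl this
  · have hxσ : Joined G F x (σ x) := by
      by_cases hxW : x ∈ W
      · rw [hσ' x (.inl hxW)]
        exact hWv x hxW hx
      · rw [hσ x hxW]
        exact .refl _
    have hσW : σ x ∉ W := by
      by_cases hxW : x ∈ W
      · rwa [hσ' x (.inl hxW)]
      · rwa [hσ x hxW]
    have : {t | Joined G F x t ∧ t ∈ T} = {t | Joined G B (σ x) t ∧ t ∈ T} := by
      ext t
      refine and_congr_left fun ht => ?_
      have htW : t ∉ W := fun h => hWT t h ht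
      constructor
      · intro hj
        have := mapσ (Q := B) (fun f hf hfV => hFout f hfV hf) hj
        rwa [hσ t htW] at this
      · intro hj
        have := mapσ (Q := F) (fun f hf hfV => .inr ⟨hf, hBE hf, hfV⟩) hj
        rw [hσ t htW, hσ _ hσW] at this
        exact hxσ.trans this
    rw [this]
    exact hBcl _ (hxσ.mem hx)

end Connectivity

/-! ### Good colourings balance the feasible sets -/

section Counting

variable {α β : Type*} {G : Graph α β} {F F' : Set β} {T : Set α} {e : β} {a b u v w : α}

/-- The edges of colour `c`. -/
def colourClass (G : Graph α β) (col : β → Bool) (c : Bool) : Set β := {e | e ∈ E(G) ∧ col e = c}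

/-- A good colouring of a graft: a colouring of the edges with two colours such that a vertex
outside `T` meets edges of one colour only, and no component of a colour class has more than two
vertices in `T`. -/
structure IsGoodColouring (G : Graph α β) (T : Set α) (col : β → Bool) : Prop where
  mono : ∀ v ∉ T, ∀ e e', G.Inc e v → G.Inc e' v → col e = col e'
  ncard_le : ∀ c u, {t | Joined G (colourClass G col c) u t ∧ t ∈ T}.ncard ≤ 2

lemma ncard_image_congr {γ δ : Type*} {S : Set α} {f : α → γ} {g : α → δ}
    (h : ∀ a ∈ S, ∀ b ∈ S, f a = f b ↔ g a = g b) : (f '' S).ncard = (g '' S).ncard := by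
  classical
  refine Set.ncard_congr (fun y hy => g hy.choose) ?_ ?_ ?_
  · intro y hy
    exact ⟨_, hy.choose_spec.1, rfl⟩
  · intro y z hy hz hyz
    rw [← hy.choose_spec.2, ← hz.choose_spec.2]
    exact (h _ hy.choose_spec.1 _ hz.choose_spec.1).2 hyz
  · rintro _ ⟨x, hx, rfl⟩
    have hy : f x ∈ f '' S := ⟨x, hx, rfl⟩
    exact ⟨f x, hy, (h _ hy.choose_spec.1 _ hx).1 hy.choose_spec.2⟩

/-- The set of vertices joined to `u` by edges of `F`. -/
def cls (G : Graph α β) (F : Set β) (u : α) : Set α := {v | Joined G F u v}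

lemma cls_eq_iff : cls G F u = cls G F v ↔ Joined G F u v := by
  constructor
  · intro h
    have : v ∈ cls G F v := Joined.refl v
    rwa [← h] at this
  · intro h
    ext w
    exact ⟨fun h' => h.symm.trans h', fun h' => h.trans h'⟩

/-- The number of edges of a forest and the number of its components add up to the number of
vertices. -/
lemma Acyclic.ncard_add_ncard_cls (hV : V(G).Finite) (hfin : F.Finite) (hE : F ⊆ E(G))
    (hF : Acyclic G F) : F.ncard + (cls G F '' V(G)).ncard = V(G).ncard := by
  induction F, hfin using Set.Finite.induction_on with
  | empty =>
    rw [Set.ncard_empty, zero_add, Set.InjOn.ncard_image]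
    intro x _ y _ hxy
    have := cls_eq_iff.1 hxy
    exact (this.mem_of_closed (S := {x}) (by simp) rfl).symm
  | @insert e F heF hfin ih =>
    have hsub : F ⊆ insert e F := Set.subset_insert e F
    have ih := ih (hsub.trans hE) (hF.mono hsub)
    obtain ⟨a, b, hl⟩ := G.exists_isLink_of_mem_edgeSet (hE (Set.mem_insert e F))
    have hab : ¬ Joined G F a b := by
      have := hF e (Set.mem_insert e F) a b hl
      rwa [Set.insert_sdiff_self_of_notMem heF] at this
    have hab' : Joined G (insert e F) a b := .of_link (Set.mem_insert e F) hl
    -- dropping the class of `b` leaves one vertex set on which both classifications agree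
    set V₀ : Set α := V(G) \ cls G F b with hV₀
    have h1 : cls G F '' V(G) = insert (cls G F b) (cls G F '' V₀) := by
      ext y
      constructor
      · rintro ⟨x, hx, rfl⟩
        by_cases hxb : Joined G F b x
        · exact .inl (cls_eq_iff.2 hxb.symm)
        · exact .inr ⟨x, ⟨hx, hxb⟩, rfl⟩
      · rintro (rfl | ⟨x, hx, rfl⟩)
        · exact ⟨b, hl.right_mem, rfl⟩
        · exact ⟨x, hx.1, rfl⟩
    have h2 : cls G F b ∉ cls G F '' V₀ := by
      rintro ⟨x, hx, hxb⟩
      exact hx.2 (cls_eq_iff.1 hxb).symm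
    have h3 : cls G (insert e F) '' V(G) = cls G (insert e F) '' V₀ := by
      refine subset_antisymm ?_ (Set.image_mono Set.sdiff_subset)
      rintro _ ⟨x, hx, rfl⟩
      by_cases hxb : Joined G F b x
      · exact ⟨a, ⟨hl.left_mem, fun h => hab (Joined.symm h)⟩,
          cls_eq_iff.2 (hab'.trans (hxb.mono hsub))⟩
      · exact ⟨x, ⟨hx, hxb⟩, rfl⟩
    have h4 : (cls G (insert e F) '' V₀).ncard = (cls G F '' V₀).ncard := by
      refine ncard_image_congr fun x hx y hy => ?_
      rw [cls_eq_iff, cls_eq_iff, joined_insert_iff hl]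
      refine or_iff_left ?_
      rintro (⟨-, h⟩ | ⟨h, -⟩)
      · exact hy.2 h
      · exact hx.2 h.symm
    rw [h1, Set.ncard_insert_of_notMem h2 ((hV.subset Set.sdiff_subset).image _)] at ih
    rw [h3, h4, Set.ncard_insert_of_notMem heF hfin]
    omega

/-- In a spanning forest `F` whose components meet `T` in odd sets, the components of a subforest
`F'` that meet `T` are numerous if each of them has at most two vertices in `T`: within a component
of `F` with `2k + 1` vertices in `T` there are at least `k + 1` of them. -/
lemma ncard_add_ncard_le_two_mul (hT : T.Finite) (hF' : F' ⊆ F)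
    (hodd : ∀ u ∈ T, Odd {t | Joined G F u t ∧ t ∈ T}.ncard)
    (htwo : ∀ u ∈ T, {t | Joined G F' u t ∧ t ∈ T}.ncard ≤ 2) :
    T.ncard + (cls G F '' T).ncard ≤ 2 * (cls G F' '' T).ncard := by
  classical
  set T' := hT.toFinset with hT'
  have hTc : (T' : Set α) = T := hT.coe_toFinset
  have himg : ∀ P : Set β, (cls G P '' T).ncard = (T'.image (cls G P)).card := by
    intro P
    rw [← Set.ncard_coe_finset, Finset.coe_image, hTc]
  rw [himg, himg, ← hTc, Set.ncard_coe_finset]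
  set C := T'.image (cls G F) with hC
  let Tk : Set α → Finset α := fun κ => T'.filter (fun t => cls G F t = κ)
  let D : Set α → Finset (Set α) := fun κ => (Tk κ).image (cls G F')
  have hTsum : T'.card = ∑ κ ∈ C, (Tk κ).card := Finset.card_eq_sum_card_image _ _
  have hDsum : (T'.image (cls G F')).card = ∑ κ ∈ C, (D κ).card := by
    rw [← Finset.card_biUnion]
    · congr 1
      ext y
      simp only [Finset.mem_image, Finset.mem_biUnion, D, Tk, Finset.mem_filter, hC]
      constructor
      · rintro ⟨t, ht, rfl⟩
        exact ⟨_, ⟨t, ht, rfl⟩, t, ⟨ht, rfl⟩, rfl⟩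
      · rintro ⟨_, _, t, ⟨ht, _⟩, rfl⟩
        exact ⟨t, ht, rfl⟩
    · intro κ _ κ' _ hne
      change Disjoint (D κ) (D κ')
      rw [Finset.disjoint_left]
      intro y hy hy'
      simp only [D, Tk, Finset.mem_image, Finset.mem_filter] at hy hy'
      obtain ⟨t, ⟨_, rfl⟩, rfl⟩ := hy
      obtain ⟨t', ⟨_, rfl⟩, h⟩ := hy'
      exact hne (cls_eq_iff.2 ((cls_eq_iff.1 h.symm).mono hF'))
  have hle : ∀ κ ∈ C, (Tk κ).card + 1 ≤ 2 * (D κ).card := by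
    intro κ hκ
    have h1 : (Tk κ).card ≤ 2 * (D κ).card := by
      refine Finset.card_le_mul_card_image _ 2 fun y hy => ?_
      obtain ⟨t, ht, rfl⟩ := Finset.mem_image.1 hy
      have htT : t ∈ T := hT.mem_toFinset.1 (Finset.mem_filter.1 ht).1
      refine le_trans ?_ (htwo t htT)
      rw [← Set.ncard_coe_finset]
      refine Set.ncard_le_ncard ?_ (hT.subset fun x hx => hx.2)
      intro x hx
      rw [Finset.mem_coe, Finset.mem_filter] at hx
      exact ⟨cls_eq_iff.1 hx.2.symm, hT.mem_toFinset.1 (Finset.mem_filter.1 hx.1).1⟩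
    have h2 : Odd (Tk κ).card := by
      obtain ⟨t, ht, rfl⟩ := Finset.mem_image.1 hκ
      have := hodd t (hT.mem_toFinset.1 ht)
      convert this using 1
      rw [← Set.ncard_coe_finset]
      congr 1
      ext x
      rw [Finset.mem_coe, Finset.mem_filter, hT', hT.mem_toFinset, and_comm, cls_eq_iff,
        joined_comm]
      rfl
    obtain ⟨k, hk⟩ := h2
    omega
  calc T'.card + C.card = ∑ κ ∈ C, ((Tk κ).card + 1) := by
        rw [Finset.sum_add_distrib, ← hTsum]; simp
    _ ≤ ∑ κ ∈ C, 2 * (D κ).card := Finset.sum_le_sum hle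
    _ = 2 * (T'.image (cls G F')).card := by rw [← Finset.mul_sum, ← hDsum]

/-- The vertices outside `T` that are incident with an edge of colour `c`. -/
def colourVerts (G : Graph α β) (T : Set α) (col : β → Bool) (c : Bool) : Set α :=
  {v | v ∉ T ∧ ∃ e, G.Inc e v ∧ col e = c}

lemma IsGoodColouring.two_mul_ncard_add_le {col : β → Bool} (hcol : IsGoodColouring G T col)
    (hV : V(G).Finite) (hEfin : E(G).Finite) (hT : T ⊆ V(G)) (hE : F ⊆ E(G)) (hF : Acyclic G F)
    (hodd : ∀ u ∈ V(G), Odd {t | Joined G F u t ∧ t ∈ T}.ncard) (c : Bool) :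
    2 * {e | e ∈ F ∧ col e = c}.ncard + (cls G F '' V(G)).ncard ≤
      2 * (colourVerts G T col c).ncard + T.ncard := by
  set Fc := {e | e ∈ F ∧ col e = c} with hFc
  set U := colourVerts G T col c with hU
  have hTfin := hV.subset hT
  have hFcF : Fc ⊆ F := fun e he => he.1
  have hUV : U ⊆ V(G) := fun v ⟨_, e, he, _⟩ => he.vertex_mem
  have hUT : Disjoint T U := Set.disjoint_left.2 fun v hv hvU => hvU.1 hv
  have h1 := (hF.mono hFcF).ncard_add_ncard_cls hV (hEfin.subset (hFcF.trans hE)) (hFcF.trans hE)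
  have h2 : T.ncard + (cls G F '' T).ncard ≤ 2 * (cls G Fc '' T).ncard := by
    refine ncard_add_ncard_le_two_mul hTfin hFcF (fun u hu => hodd u (hT hu)) fun u _ => ?_
    refine le_trans (Set.ncard_le_ncard ?_ (hTfin.subset fun t ht => ht.2)) (hcol.ncard_le c u)
    exact fun t ht => ⟨ht.1.mono fun e he => ⟨hE he.1, he.2⟩, ht.2⟩
  have h3 : cls G F '' V(G) = cls G F '' T := by
    refine subset_antisymm ?_ (Set.image_mono hT)
    rintro _ ⟨x, hx, rfl⟩
    obtain ⟨t, ht, htT⟩ : {t | Joined G F x t ∧ t ∈ T}.Nonempty :=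
      Set.nonempty_of_ncard_ne_zero (hodd x hx).pos.ne'
    exact ⟨t, htT, cls_eq_iff.2 ht.symm⟩
  -- a vertex in neither `T` nor `U` meets no edge of colour `c`
  set R := V(G) \ (T ∪ U) with hR
  have hiso : ∀ x ∈ R, ∀ y, Joined G Fc x y → y = x := by
    intro x hx y hxy
    refine hxy.mem_of_closed (S := {x}) ?_ rfl
    rintro e he p q hl rfl
    exact absurd ⟨fun h => hx.2 (.inl h), e, hl.inc_left, he.2⟩ fun h => hx.2 (.inr h)
  have h4 : R.ncard + (cls G Fc '' T).ncard ≤ (cls G Fc '' V(G)).ncard := by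
    have hRi : (cls G Fc '' R).ncard = R.ncard := by
      refine Set.InjOn.ncard_image fun x hx y hy hxy => ?_
      exact (hiso x hx y (cls_eq_iff.1 hxy)).symm
    rw [← hRi, ← Set.ncard_union_eq ?_ ((hV.subset Set.sdiff_subset).image _) (hTfin.image _)]
    · refine Set.ncard_le_ncard (Set.union_subset ?_ ?_) (hV.image _)
      · exact Set.image_mono Set.sdiff_subset
      · exact Set.image_mono hT
    · rw [Set.disjoint_left]
      rintro _ ⟨x, hx, rfl⟩ ⟨t, ht, heq⟩
      have := hiso x hx t (cls_eq_iff.1 heq.symm)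
      exact hx.2 (.inl (this ▸ ht))
  have h5 : R.ncard + (T.ncard + U.ncard) = V(G).ncard := by
    rw [← Set.ncard_union_eq hUT hTfin (hV.subset hUV)]
    exact Set.ncard_sdiff_add_ncard_of_subset (Set.union_subset hT hUV) hV
  rw [h3]
  omega

lemma ncard_symmDiff_add {Z : Set β} (hF : F.Finite) (hZ : Z.Finite) :
    (symmDiff F Z).ncard + (F ∩ Z).ncard = (F \ Z).ncard + Z.ncard := by
  have h1 : (symmDiff F Z).ncard = (F \ Z).ncard + (Z \ F).ncard := by
    rw [Set.symmDiff_def, Set.ncard_union_eq (by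
      rw [Set.disjoint_left]; exact fun x hx hx' => hx.2 hx'.1) (hF.subset Set.sdiff_subset)
      (hZ.subset Set.sdiff_subset)]
  have h2 := Set.ncard_inter_add_ncard_sdiff_eq_ncard Z F hZ
  rw [Set.inter_comm] at h2
  omega

/-- All forests `F` whose components meet `T` in odd sets, the feasible sets of a connected graft with
`T ≠ ∅`, have a symmetric difference of size `n` with `Z`. -/
def BalancedBy (G : Graph α β) (T : Set α) (Z : Set β) (n : ℕ) : Prop :=
  ∀ F ⊆ E(G), Acyclic G F → (∀ u ∈ V(G), Odd {t | Joined G F u t ∧ t ∈ T}.ncard) →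
    (symmDiff F Z).ncard = n

/-- The upper bounds on the number of edges of each colour in a feasible set add up to the number of
all its edges, so they are attained and the difference of the two numbers is constant. -/
lemma IsGoodColouring.exists_balancedBy {col : β → Bool} (hcol : IsGoodColouring G T col)
    (hG : ∀ v, ¬ IsIsolated G v) (hV : V(G).Finite) (hEfin : E(G).Finite) (hT : T ⊆ V(G)) :
    ∃ Z ⊆ E(G), ∃ n, BalancedBy G T Z n := by
  set Z : Set β := {e | e ∈ E(G) ∧ col e = true} with hZ
  set U := colourVerts G T col with hU
  have hZE : Z ⊆ E(G) := fun e he => he.1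
  refine ⟨Z, hZE, Z.ncard + (U false).ncard - (U true).ncard, fun F hE hF hodd => ?_⟩
  have hFfin := hEfin.subset hE
  have hTfin := hV.subset hT
  have h1 := hcol.two_mul_ncard_add_le hV hEfin hT hE hF hodd true
  have h2 := hcol.two_mul_ncard_add_le hV hEfin hT hE hF hodd false
  have h3 := hF.ncard_add_ncard_cls hV hFfin hE
  have hUV : ∀ c, U c ⊆ V(G) := fun c v ⟨_, e, he, _⟩ => he.vertex_mem
  have h4 : (U true).ncard + (U false).ncard + T.ncard = V(G).ncard := by
    rw [← Set.ncard_sdiff_add_ncard_of_subset hT hV, ← Set.ncard_union_eq _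
      (hV.subset (hUV _)) (hV.subset (hUV _))]
    · congr 2
      ext v
      constructor
      · rintro (h | h)
        · exact ⟨hUV _ h, h.1⟩
        · exact ⟨hUV _ h, h.1⟩
      · rintro ⟨hv, hvT⟩
        obtain ⟨e, he⟩ : ∃ e, G.Inc e v := by
          by_contra! h
          exact hG v ⟨hv, h⟩
        cases hc : col e
        · exact .inr ⟨hvT, e, he, hc⟩
        · exact .inl ⟨hvT, e, he, hc⟩
    · rw [Set.disjoint_left]
      rintro v ⟨hvT, e, he, hc⟩ ⟨_, e', he', hc'⟩
      have := hcol.mono v hvT e e' he he'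
      rw [hc, hc'] at this
      exact absurd this (by simp)
  have h5 : F ∩ Z = {e | e ∈ F ∧ col e = true} := by
    ext e
    exact ⟨fun h => ⟨h.1, h.2.2⟩, fun h => ⟨h.1, hE h.1, h.2⟩⟩
  have h6 : F \ Z = {e | e ∈ F ∧ col e = false} := by
    ext e
    constructor
    · rintro ⟨h, h'⟩
      refine ⟨h, ?_⟩
      cases hc : col e
      · rfl
      · exact absurd ⟨hE h, hc⟩ h'
    · rintro ⟨h, h'⟩
      exact ⟨h, fun h'' => by rw [h''.2] at h'; exact absurd h' (by simp)⟩
  have h7 := Set.ncard_inter_add_ncard_sdiff_eq_ncard F Z hFfin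
  have h8 := ncard_symmDiff_add hFfin (hEfin.subset hZE)
  rw [h5, h6] at h7
  rw [h5, h6] at h8
  change _ ≤ 2 * (U true).ncard + _ at h1
  change _ ≤ 2 * (U false).ncard + _ at h2
  omega

end Counting

/-! ### Balanced feasible sets give a good colouring -/

section RootedForests

variable {α β : Type*} {G : Graph α β} {F F' Z : Set β} {T : Set α} {n : ℕ} {x y e : β}
  {a b c d t u v w : α}

/-- A spanning forest each of whose components contains exactly one vertex of `T`, its root. -/
structure IsRootedForest (G : Graph α β) (T : Set α) (F : Set β) : Prop where
  subset : F ⊆ E(G)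
  acyclic : Acyclic G F
  unique : ∀ t ∈ T, ∀ t' ∈ T, Joined G F t t' → t = t'
  reach : ∀ u ∈ V(G), ∃ t ∈ T, Joined G F u t

lemma exists_isRootedForest (hE : E(G).Finite) (hcon : ∀ u ∈ V(G), ∀ v ∈ V(G), Joined G E(G) u v)
    (hT : T ⊆ V(G)) (hne : T.Nonempty) : ∃ F, IsRootedForest G T F := by
  let P : Set (Set β) := {F | F ⊆ E(G) ∧ Acyclic G F ∧ ∀ t ∈ T, ∀ t' ∈ T, Joined G F t t' → t = t'}
  have hP : P.Finite := hE.finite_subsets.subset fun F hF => hF.1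
  have h0 : P.Nonempty := by
    refine ⟨∅, Set.empty_subset _, fun e he => absurd he (Set.notMem_empty e), fun t _ t' _ h => ?_⟩
    exact (h.mem_of_closed (S := {t}) (by simp) rfl).symm
  obtain ⟨F, hF⟩ := hP.exists_maximal h0
  obtain ⟨hFE, hac, huni⟩ := hF.prop
  refine ⟨F, hFE, hac, huni, ?_⟩
  -- otherwise an edge leaves the set of vertices joined to `T`, and it can be added to `F`
  by_contra! hcon'
  obtain ⟨u, hu, hut⟩ := hcon'
  obtain ⟨t₀, ht₀⟩ := hne
  have : ∃ e a b, G.IsLink e a b ∧ (∃ t ∈ T, Joined G F a t) ∧ ∀ t ∈ T, ¬ Joined G F b t := by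
    by_contra! h
    have := (hcon t₀ (hT ht₀) u hu).mem_of_closed (S := {a | ∃ t ∈ T, Joined G F a t})
      (fun e _ a b hl ha => h e a b hl ha) ⟨t₀, ht₀, .refl _⟩
    obtain ⟨t, ht, h'⟩ := this
    exact hut t ht h'
  obtain ⟨e, a, b, hl, ⟨t, ht, hat⟩, hb⟩ := this
  have hab : ¬ Joined G F a b := fun h => hb t ht (h.symm.trans hat)
  have heF : e ∉ F := fun h => hab (.of_link h hl)
  have hins : insert e F ∈ P := by
    refine ⟨Set.insert_subset hl.edge_mem hFE, hac.insert_edge hl hab, fun s hs s' hs' h => ?_⟩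
    rcases (joined_insert_iff hl).1 h with h | ⟨-, h⟩ | ⟨h, -⟩
    · exact huni s hs s' hs' h
    · exact absurd h (hb s' hs')
    · exact absurd h.symm (hb s hs)
  exact heF (hF.le_of_ge hins (Set.subset_insert e F) (Set.mem_insert e F))

lemma IsRootedForest.odd (hF : IsRootedForest G T F) (hu : u ∈ V(G)) :
    Odd {t | Joined G F u t ∧ t ∈ T}.ncard := by
  obtain ⟨t, ht, hut⟩ := hF.reach u hu
  have : {t | Joined G F u t ∧ t ∈ T} = {t} := by
    ext s
    refine ⟨fun hs => hF.unique s hs.2 t ht (hs.1.symm.trans hut), ?_⟩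
    rintro rfl
    exact ⟨hut, ht⟩
  rw [this, Set.ncard_singleton]
  exact odd_one

lemma ncard_symmDiff_insert (hF : F.Finite) (hZ : Z.Finite) (hx : x ∉ F) :
    (x ∈ Z ∧ (symmDiff (insert x F) Z).ncard + 1 = (symmDiff F Z).ncard) ∨
      (x ∉ Z ∧ (symmDiff (insert x F) Z).ncard = (symmDiff F Z).ncard + 1) := by
  have hfin : (symmDiff F Z).Finite := (hF.union hZ).subset Set.symmDiff_subset_union
  by_cases hxZ : x ∈ Z
  · refine .inl ⟨hxZ, ?_⟩
    have h1 : x ∈ symmDiff F Z := .inr ⟨hxZ, hx⟩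
    have h2 : symmDiff (insert x F) Z = symmDiff F Z \ {x} := by
      ext z
      by_cases hz : z = x
      · subst hz; simp [Set.mem_symmDiff, hxZ]
      · simp [Set.mem_symmDiff, hz]
    rw [h2, Set.ncard_sdiff_singleton_add_one h1 hfin]
  · refine .inr ⟨hxZ, ?_⟩
    have h1 : x ∉ symmDiff F Z := by simp [Set.mem_symmDiff, hx, hxZ]
    have h2 : symmDiff (insert x F) Z = insert x (symmDiff F Z) := by
      ext z
      by_cases hz : z = x
      · subst hz; simp [Set.mem_symmDiff, hxZ]
      · simp [Set.mem_symmDiff, hz]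
    rw [h2, Set.ncard_insert_of_notMem h1 hfin]

lemma BalancedBy.swap (hZ : BalancedBy G T Z n) (hE : E(G).Finite) (hZE : Z ⊆ E(G))
    (hF : IsRootedForest G T F) (hy : y ∈ F) (hx : x ∉ F)
    (hF' : IsRootedForest G T (insert x (F \ {y}))) : x ∈ Z ↔ y ∈ Z := by
  have h1 := hZ F hF.subset hF.acyclic fun u hu => hF.odd hu
  have h2 := hZ _ hF'.subset hF'.acyclic fun u hu => hF'.odd hu
  have hfin : (F \ {y}).Finite := hE.subset (Set.sdiff_subset.trans hF.subset)
  have h3 := ncard_symmDiff_insert (Z := Z) hfin (hE.subset hZE) (x := x) fun h => hx h.1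
  have h4 := ncard_symmDiff_insert (Z := Z) hfin (hE.subset hZE) (x := y) fun h => h.2 rfl
  rw [Set.insert_sdiff_singleton, Set.insert_eq_of_mem hy, h1] at h4
  rw [h2] at h3
  rcases h3 with ⟨h5, h3⟩ | ⟨h5, h3⟩ <;> rcases h4 with ⟨h6, h4⟩ | ⟨h6, h4⟩ <;>
    first | (exfalso; omega) | simp [h5, h6]

/-- Exchanging an edge of `F` for a chord of its component that closes a cycle with it. -/
lemma BalancedBy.iff_of_chord (hZ : BalancedBy G T Z n) (hE : E(G).Finite) (hZE : Z ⊆ E(G))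
    (hF : IsRootedForest G T F) (hl : G.IsLink x a b) (hx : x ∉ F) (hab : Joined G F a b)
    (hy : y ∈ F) (hyab : ¬ Joined G (F \ {y}) a b) : x ∈ Z ↔ y ∈ Z := by
  refine hZ.swap hE hZE hF hy hx ?_
  obtain ⟨c, d, hcd, hac, hdb⟩ : ∃ c d, G.IsLink y c d ∧ Joined G (F \ {y}) a c ∧
      Joined G (F \ {y}) d b := by
    obtain ⟨c, d, hcd⟩ := G.exists_isLink_of_mem_edgeSet (hF.subset hy)
    rcases hab.split hcd with h | h | h
    · exact absurd h hyab
    · exact ⟨c, d, hcd, h⟩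
    · exact ⟨d, c, hcd.symm, h⟩
  set F' := insert x (F \ {y}) with hF'
  have hsub : F \ {y} ⊆ F' := Set.subset_insert _ _
  have hcd' : Joined G F' c d :=
    ((hac.mono hsub).symm.trans (.of_link (Set.mem_insert _ _) hl)).trans (hdb.mono hsub).symm
  have h1 : ∀ {p q}, Joined G F p q → Joined G F' p q := by
    intro p q h
    refine h.map id fun f hf r s hrs => ?_
    by_cases hfy : f = y
    · subst hfy
      obtain ⟨rfl, rfl⟩ | ⟨rfl, rfl⟩ := hrs.eq_and_eq_or_eq_and_eq hcd
      · exact hcd'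
      · exact hcd'.symm
    · exact .of_link (hsub ⟨hf, hfy⟩) hrs
  have h2 : ∀ {p q}, Joined G F' p q → Joined G F p q := by
    intro p q h
    refine h.map id fun f hf r s hrs => ?_
    rcases hf with rfl | hf
    · obtain ⟨rfl, rfl⟩ | ⟨rfl, rfl⟩ := hrs.eq_and_eq_or_eq_and_eq hl
      · exact hab
      · exact hab.symm
    · exact .of_link hf.1 hrs
  refine ⟨?_, (hF.acyclic.mono Set.sdiff_subset).insert_edge hl hyab,
    fun t ht t' ht' h => hF.unique t ht t' ht' (h2 h), fun u hu => ?_⟩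
  · exact Set.insert_subset hl.edge_mem (Set.sdiff_subset.trans hF.subset)
  · obtain ⟨t, ht, h⟩ := hF.reach u hu
    exact ⟨t, ht, h1 h⟩

/-- Exchanging an edge of `F` on the path from `a` to its root for an edge that joins `a` to another
component. -/
lemma BalancedBy.iff_of_root (hZ : BalancedBy G T Z n) (hE : E(G).Finite) (hZE : Z ⊆ E(G))
    (hF : IsRootedForest G T F) (hl : G.IsLink x a b) (hab : ¬ Joined G F a b)
    (ht : t ∈ T) (hat : Joined G F a t) (hy : y ∈ F) (hyat : ¬ Joined G (F \ {y}) a t) :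
    x ∈ Z ↔ y ∈ Z := by
  have hx : x ∉ F := fun h => hab (.of_link h hl)
  refine hZ.swap hE hZE hF hy hx ?_
  obtain ⟨c, d, hcd, hac, hdt⟩ : ∃ c d, G.IsLink y c d ∧ Joined G (F \ {y}) a c ∧
      Joined G (F \ {y}) d t := by
    obtain ⟨c, d, hcd⟩ := G.exists_isLink_of_mem_edgeSet (hF.subset hy)
    rcases hat.split hcd with h | h | h
    · exact absurd h hyat
    · exact ⟨c, d, hcd, h⟩
    · exact ⟨d, c, hcd.symm, h⟩
  set F' := insert x (F \ {y}) with hF'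
  have hsub : F \ {y} ⊆ F' := Set.subset_insert _ _
  have hle : F \ {y} ⊆ F := Set.sdiff_subset
  refine ⟨Set.insert_subset hl.edge_mem (hle.trans hF.subset),
    (hF.acyclic.mono hle).insert_edge hl fun h => hab (h.mono hle), fun s hs s' hs' h => ?_,
    fun u hu => ?_⟩
  · rcases (joined_insert_iff hl).1 h with h | ⟨h, -⟩ | ⟨-, h⟩
    · exact hF.unique s hs s' hs' (h.mono hle)
    · have : s = t := hF.unique s hs t ht ((h.mono hle).trans hat)
      subst this
      exact absurd h.symm hyat
    · have : s' = t := hF.unique s' hs' t ht ((h.mono hle).symm.trans hat)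
      subst this
      exact absurd h hyat
  · obtain ⟨s, hs, hus⟩ := hF.reach u hu
    rcases hus.split hcd with h | ⟨h, -⟩ | ⟨h, -⟩
    · exact ⟨s, hs, h.mono hsub⟩
    · obtain ⟨r, hr, hbr⟩ := hF.reach b hl.right_mem
      have hbr' : Joined G (F \ {y}) b r := by
        rcases hbr.split hcd with h | ⟨h, -⟩ | ⟨h, -⟩
        · exact h
        · exact absurd ((hac.trans h.symm).mono hle) hab
        · exact absurd (hat.trans ((h.trans hdt).mono hle).symm) hab
      exact ⟨r, hr, (((h.trans hac.symm).mono hsub).trans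
        (.of_link (Set.mem_insert _ _) hl)).trans (hbr'.mono hsub)⟩
    · exact ⟨t, ht, (h.trans hdt).mono hsub⟩

/-- Adding two edges that join one component of `F` to two others makes a component with three
vertices in `T`. -/
lemma BalancedBy.iff_not_of_cross (hZ : BalancedBy G T Z n) (hE : E(G).Finite) (hZE : Z ⊆ E(G))
    (hF : IsRootedForest G T F) (hx : G.IsLink x a b) (hy : G.IsLink y c d)
    (hab : ¬ Joined G F a b) (hbc : Joined G F b c) (hcd : ¬ Joined G F c d)
    (had : ¬ Joined G F a d) : x ∈ Z ↔ y ∉ Z := by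
  have hxF : x ∉ F := fun h => hab (.of_link h hx)
  have hyF : y ∉ F := fun h => hcd (.of_link h hy)
  have hab' : ¬ Joined G (insert y F) a b := by
    rw [joined_insert_iff hy]
    rintro (h | ⟨h, -⟩ | ⟨h, -⟩)
    · exact hab h
    · exact hab (h.trans hbc.symm)
    · exact had h
  have hxy : x ≠ y := by
    rintro rfl
    exact hab' (.of_link (Set.mem_insert _ _) hx)
  set F' := insert x (insert y F) with hF'
  have hsub : F ⊆ F' := (Set.subset_insert _ _).trans (Set.subset_insert _ _)
  have hac : Acyclic G F' := (hF.acyclic.insert_edge hy hcd).insert_edge hx hab'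
  let P : α → Prop := fun z => Joined G F a z ∨ Joined G F b z ∨ Joined G F d z
  have hPF : ∀ {z z'}, P z → Joined G F z z' → P z' := by
    rintro z z' (h | h | h) h'
    · exact .inl (h.trans h')
    · exact .inr (.inl (h.trans h'))
    · exact .inr (.inr (h.trans h'))
  have hPb : ∀ z, P z → Joined G F' b z := by
    rintro z (h | h | h)
    · exact (Joined.of_link (Set.mem_insert _ _) hx.symm).trans (h.mono hsub)
    · exact h.mono hsub
    · exact ((hbc.mono hsub).trans
        (.of_link (Set.mem_insert_of_mem _ (Set.mem_insert _ _)) hy)).trans (h.mono hsub)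
  have hiff : ∀ u w, Joined G F' u w ↔ Joined G F u w ∨ (P u ∧ P w) := by
    intro u w
    constructor
    · intro h
      refine h.mem_of_closed (S := {w | Joined G F u w ∨ (P u ∧ P w)}) ?_ (.inl (.refl _))
      have aux : ∀ {p q}, P p → P q → (Joined G F u p ∨ (P u ∧ P p)) →
          (Joined G F u q ∨ (P u ∧ P q)) := by
        rintro p q hp hq (h | h)
        · exact .inr ⟨hPF hp h.symm, hq⟩
        · exact .inr ⟨h.1, hq⟩
      have ha : P a := .inl (.refl _)
      have hb : P b := .inr (.inl (.refl _))
      have hc : P c := .inr (.inl hbc)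
      have hd : P d := .inr (.inr (.refl _))
      rintro f (rfl | rfl | hf) p q hl hp
      · obtain ⟨rfl, rfl⟩ | ⟨rfl, rfl⟩ := hl.eq_and_eq_or_eq_and_eq hx
        · exact aux ha hb hp
        · exact aux hb ha hp
      · obtain ⟨rfl, rfl⟩ | ⟨rfl, rfl⟩ := hl.eq_and_eq_or_eq_and_eq hy
        · exact aux hc hd hp
        · exact aux hd hc hp
      · have hpq := Joined.of_link hf hl
        rcases hp with h | h
        · exact .inl (h.trans hpq)
        · exact .inr ⟨h.1, hPF h.2 hpq⟩
    · rintro (h | ⟨h, h'⟩)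
      · exact h.mono hsub
      · exact (hPb u h).symm.trans (hPb w h')
  have hodd : ∀ u ∈ V(G), Odd {t | Joined G F' u t ∧ t ∈ T}.ncard := by
    intro u hu
    by_cases hPu : P u
    · obtain ⟨r₁, hr₁, h₁⟩ := hF.reach a hx.left_mem
      obtain ⟨r₂, hr₂, h₂⟩ := hF.reach b hx.right_mem
      obtain ⟨r₃, hr₃, h₃⟩ := hF.reach d hy.right_mem
      have : {t | Joined G F' u t ∧ t ∈ T} = {r₁, r₂, r₃} := by
        ext s
        simp only [Set.mem_ofPred_eq, hiff, Set.mem_insert_iff, Set.mem_singleton_iff]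
        constructor
        · rintro ⟨h, hs⟩
          have hPs : P s := by
            rcases h with h | h
            · exact hPF hPu h
            · exact h.2
          rcases hPs with h | h | h
          · exact .inl (hF.unique _ hs _ hr₁ (h.symm.trans h₁))
          · exact .inr (.inl (hF.unique _ hs _ hr₂ (h.symm.trans h₂)))
          · exact .inr (.inr (hF.unique _ hs _ hr₃ (h.symm.trans h₃)))
        · rintro (rfl | rfl | rfl)
          · exact ⟨.inr ⟨hPu, .inl h₁⟩, hr₁⟩
          · exact ⟨.inr ⟨hPu, .inr (.inl h₂)⟩, hr₂⟩
          · exact ⟨.inr ⟨hPu, .inr (.inr h₃)⟩, hr₃⟩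
      rw [this, Set.ncard_eq_three.2 ⟨r₁, r₂, r₃, ?_, ?_, ?_, rfl⟩]
      · decide
      · rintro rfl
        exact hab (h₁.trans h₂.symm)
      · rintro rfl
        exact had (h₁.trans h₃.symm)
      · rintro rfl
        exact hcd (hbc.symm.trans (h₂.trans h₃.symm))
    · have : {t | Joined G F' u t ∧ t ∈ T} = {t | Joined G F u t ∧ t ∈ T} := by
        ext s
        simp only [Set.mem_ofPred_eq, hiff, hPu, false_and, or_false]
      rw [this]
      exact hF.odd hu
  have h1 := hZ F hF.subset hF.acyclic fun u hu => hF.odd hu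
  have h2 := hZ F' (Set.insert_subset hx.edge_mem (Set.insert_subset hy.edge_mem hF.subset)) hac hodd
  have hfin : F.Finite := hE.subset hF.subset
  have h3 := ncard_symmDiff_insert (Z := Z) hfin (hE.subset hZE) hyF
  have h4 := ncard_symmDiff_insert (Z := Z) (hfin.insert y) (hE.subset hZE) (x := x)
    (by simp [hxy, hxF])
  rw [h1] at h3
  rw [h2] at h4
  rcases h3 with ⟨h5, h3⟩ | ⟨h5, h3⟩ <;> rcases h4 with ⟨h6, h4⟩ | ⟨h6, h4⟩ <;>
    first | (exfalso; omega) | simp [h5, h6]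

/-- A walk that avoids the edge `f` at `v` and ends at its other end `v'` can be prolonged to `v` and
then avoids every other edge `g` of the forest at `v`. -/
lemma Acyclic.joined_of_branch {f g : β} {v' v'' : α} (hF : Acyclic G F) (hf : f ∈ F) (hfg : f ≠ g)
    (hlf : G.IsLink f v' v) (hlg : G.IsLink g v'' v) (h : Joined G (F \ {f}) u v') :
    Joined G (F \ {g}) u v := by
  have hsub : (F \ {f}) \ {g} ⊆ F \ {g} := Set.sdiff_subset_sdiff_left Set.sdiff_subset
  have hsub' : (F \ {f}) \ {g} ⊆ F \ {f} := Set.sdiff_subset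
  rcases h.split hlg with h | ⟨-, h⟩ | ⟨h, -⟩
  · exact (h.mono hsub).trans (.of_link ⟨hf, hfg⟩ hlf)
  · exact absurd (h.mono hsub').symm (hF f hf _ _ hlf)
  · exact h.mono hsub

/-- All edges at a vertex `v ∉ T` lie on the same side of `Z`: otherwise the branches of the rooted
forest that hang at `v` by an edge on the other side than the edge towards the root form a
part of the graft that hangs at `v`. -/
lemma BalancedBy.mem_iff_of_notMem (hZ : BalancedBy G T Z n) (hE : E(G).Finite) (hZE : Z ⊆ E(G))
    (hcon : ∀ u ∈ V(G), ∀ v ∈ V(G), Joined G E(G) u v) (hT : T ⊆ V(G)) (hne : T.Nonempty)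
    (hins : Inseparable G T) (hloop : ∀ e a, ¬ G.IsLink e a a)
    (hF : IsRootedForest G T F) (hv : v ∈ V(G)) (hvT : v ∉ T) :
    ∃ p, ∀ e, G.Inc e v → (e ∈ Z ↔ p ∈ Z) := by
  have hfin : F.Finite := hE.subset hF.subset
  have hac := hF.acyclic
  obtain ⟨r, hr, hvr⟩ := hF.reach v hv
  obtain ⟨p, hp, w, hpl, hrw⟩ := hvr.symm.exists_last hfin fun h => hvT (h ▸ hr)
  have hnp : ¬ Joined G (F \ {p}) v r := fun h => hac p hp _ _ hpl (h.trans hrw).symm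
  refine ⟨p, ?_⟩
  have hchild : ∀ f ∈ F, ∀ v', G.IsLink f v' v → (f ∈ Z ↔ p ∈ Z) := by
    by_contra! hbad
    obtain ⟨f₀, hf₀, v₀, hl₀, hne₀⟩ := hbad
    have hbad₀ : f₀ ∈ Z ↔ p ∉ Z := by tauto
    let W : Set α := {x | ∃ f ∈ F, ∃ v', G.IsLink f v' v ∧ (f ∈ Z ↔ p ∉ Z) ∧ Joined G (F \ {f}) x v'}
    have hWp : ∀ x ∈ W, Joined G (F \ {p}) x v := by
      rintro x ⟨f, hf, v', hl, hfp, hx⟩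
      exact hac.joined_of_branch hf (by rintro rfl; tauto) hl hpl hx
    have hvW : v ∉ W := by
      rintro ⟨f, hf, v', hl, -, hx⟩
      exact hac f hf _ _ hl hx.symm
    have hwW : w ∉ W := fun hw => hac p hp _ _ hpl (hWp w hw)
    have hWT : ∀ x ∈ W, x ∉ T := by
      intro x hx hxT
      have h1 := hWp x hx
      have : x = r := hF.unique x hxT r hr ((h1.mono Set.sdiff_subset).trans hvr)
      subst this
      exact hnp h1.symm
    have hv₀ : v₀ ∈ W := ⟨f₀, hf₀, v₀, hl₀, hbad₀, .refl _⟩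
    refine hins.no_pendant hcon hT hne hvW hWT ?_ hl₀ hv₀ hpl hwW hvW
    intro e a b hl ha
    by_contra! hb
    obtain ⟨hbW, hbv⟩ := hb
    have hap := hWp a ha
    have hav : a ≠ v := fun h => hvW (h ▸ ha)
    obtain ⟨f, hf, v', hlf, hfp, hx⟩ := ha
    by_cases heF : e ∈ F
    · by_cases hef : e = f
      · subst hef
        obtain ⟨-, h⟩ | ⟨h, -⟩ := hl.eq_and_eq_or_eq_and_eq hlf
        · exact hbv h
        · exact hav h
      · have hba : Joined G (F \ {f}) b a := .of_link ⟨heF, hef⟩ hl.symm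
        exact hbW ⟨f, hf, v', hlf, hfp, hba.trans hx⟩
    · by_cases hab : Joined G F a b
      · obtain ⟨g, hg, v'', hlg, hbg⟩ := Joined.exists_last hfin
          (hab.symm.trans (hap.mono Set.sdiff_subset)) hbv
        have hgp : ¬ (g ∈ Z ↔ p ∉ Z) := fun h => hbW ⟨g, hg, v'', hlg, h, hbg⟩
        have h1 := hZ.iff_of_chord hE hZE hF hl heF hab hf fun h =>
          hbW ⟨f, hf, v', hlf, hfp, h.symm.trans hx⟩
        have h2 := hZ.iff_of_chord hE hZE hF hl heF hab hg fun h => by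
          have hag := hac.joined_of_branch hf (by rintro rfl; exact hgp hfp) hlf hlg hx
          exact hac g hg _ _ hlg ((hbg.symm.trans h.symm).trans hag)
        tauto
      · have har : Joined G F a r := (hap.mono Set.sdiff_subset).trans hvr
        have hrf := hac.joined_of_branch hp (g := f) (by rintro rfl; tauto) hpl hlf hrw
        have h1 := hZ.iff_of_root hE hZE hF hl hab hr har hf fun h =>
          hac f hf _ _ hlf ((hx.symm.trans h).trans hrf)
        have h2 := hZ.iff_of_root hE hZE hF hl hab hr har hp fun h => hnp (hap.symm.trans h)
        tauto
  rintro e ⟨b, hl⟩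
  by_cases heF : e ∈ F
  · exact hchild e heF b hl.symm
  by_cases hvb : Joined G F v b
  · have hbv : b ≠ v := by
      rintro rfl
      exact hloop e b hl
    obtain ⟨g, hg, v'', hlg, hbg⟩ := Joined.exists_last hfin hvb.symm hbv
    rw [← hchild g hg v'' hlg]
    exact hZ.iff_of_chord hE hZE hF hl heF hvb hg fun h =>
      hac g hg _ _ hlg (hbg.symm.trans h.symm)
  · exact hZ.iff_of_root hE hZE hF hl hvb hr hvr hp hnp

/-- If a set `Z` balances the feasible sets of an inseparable graft, then membership in `Z` is a good
colouring of its edges. -/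
lemma BalancedBy.exists_isGoodColouring (hZ : BalancedBy G T Z n) (hE : E(G).Finite)
    (hZE : Z ⊆ E(G)) (hcon : ∀ u ∈ V(G), ∀ v ∈ V(G), Joined G E(G) u v) (hT : T ⊆ V(G))
    (hne : T.Nonempty) (hins : Inseparable G T) (hloop : ∀ e a, ¬ G.IsLink e a a) :
    ∃ col, IsGoodColouring G T col := by
  classical
  obtain ⟨F, hF⟩ := exists_isRootedForest hE hcon hT hne
  refine ⟨fun e => decide (e ∈ Z), fun v hvT e e' he he' => ?_, fun c u => ?_⟩
  · obtain ⟨p, hp⟩ := hZ.mem_iff_of_notMem hE hZE hcon hT hne hins hloop hF he.vertex_mem hvT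
    rw [decide_eq_decide, hp e he, hp e' he']
  · set Ec : Set β := {e | e ∈ E(G) ∧ decide (e ∈ Z) = c} with hEc
    have hcol : ∀ x ∈ Ec, ∀ y ∈ Ec, (x ∈ Z ↔ y ∈ Z) := by
      rintro x ⟨-, hx⟩ y ⟨-, hy⟩
      rw [← decide_eq_decide, hx, hy]
    have key : ∀ s t, Joined G Ec s t → Joined G F s t ∨ ∃ x ∈ Ec, ∃ a b, G.IsLink x a b ∧
        ¬ Joined G F a b ∧ Joined G F s a ∧ Joined G F b t := by
      intro s t hst
      refine hst.mem_of_closed (S := {t | Joined G F s t ∨ ∃ x ∈ Ec, ∃ a b, G.IsLink x a b ∧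
        ¬ Joined G F a b ∧ Joined G F s a ∧ Joined G F b t}) ?_ (.inl (.refl _))
      rintro e he p q hl hp
      by_cases hpq : Joined G F p q
      · rcases hp with hp | ⟨x, hx, a, b, hab, hnab, hsa, hbp⟩
        · exact .inl (hp.trans hpq)
        · exact .inr ⟨x, hx, a, b, hab, hnab, hsa, hbp.trans hpq⟩
      · rcases hp with hp | ⟨x, hx, a, b, hab, hnab, hsa, hbp⟩
        · exact .inr ⟨e, he, p, q, hl, hpq, hp, .refl _⟩
        · refine .inl (hsa.trans ?_)
          by_contra haq
          have := hZ.iff_not_of_cross hE hZE hF hab hl hnab hbp hpq haq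
          have := hcol x hx e he
          tauto
    by_contra! h
    obtain ⟨t₁, t₂, t₃, ht₁, ht₂, ht₃, h12, h13, h23⟩ :=
      (Set.two_lt_ncard_iff (Set.finite_of_ncard_pos (by omega))).1 h
    have hnj : ∀ {s t}, s ∈ T → t ∈ T → s ≠ t → ¬ Joined G F s t := fun hs ht hst h =>
      hst (hF.unique _ hs _ ht h)
    rcases key _ _ (ht₁.1.symm.trans ht₂.1) with h | ⟨x, hx, a, b, hxl, hab, h1a, hb2⟩
    · exact hnj ht₁.2 ht₂.2 h12 h
    rcases key _ _ (ht₂.1.symm.trans ht₃.1) with h | ⟨y, hy, c', d, hyl, hcd, h2c, hd3⟩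
    · exact hnj ht₂.2 ht₃.2 h23 h
    have := hZ.iff_not_of_cross hE hZE hF hxl hyl hab (hb2.trans h2c) hcd fun h =>
      hnj ht₁.2 ht₃.2 h13 ((h1a.trans h).trans hd3)
    have := hcol x hx y hy
    tauto

end RootedForests

/-! ### Alternating orders -/

section Enumeration

variable {α : Type*}

/-- The members of `T` in linear or cyclic order. The index set `I` is `ℤ` or `ZMod m`. For `i ∈ S`
the consecutive members `f i` and `f (i + 1)` are partners in the matching `p (c i)`, the two
matchings alternate, and no further members have partners. -/
structure IsAlternatingOrder {I : Type} [CommRing I] (p : Bool → α → α → Prop) (S : Set I)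
    (f : I → α) (c : I → Bool) : Prop where
  partner : ∀ i ∈ S, p (c i) (f i) (f (i + 1))
  alternate : ∀ i ∈ S, i + 1 ∈ S → c (i + 1) ≠ c i
  inj : ∀ i ∈ S, ∀ j ∈ S, f i = f j → i = j
  inj_succ : ∀ i ∈ S, ∀ j ∈ S, f i = f (j + 1) → i = j + 1
  inj_succ_succ : ∀ i ∈ S, ∀ j ∈ S, f (i + 1) = f (j + 1) → i = j
  cover : ∀ k s t, p k s t → ∃ i ∈ S, c i = k ∧ (s = f i ∨ s = f (i + 1))

/-- The union of two disjoint matchings on a set of at least three members, if connected, is a path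
or an even cycle. -/
lemma exists_isAlternatingOrder {T : Set α} {p : Bool → α → α → Prop} (hT : 3 ≤ T.ncard)
    (hmem : ∀ k s t, p k s t → s ∈ T) (hsymm : ∀ k s t, p k s t → p k t s)
    (hne : ∀ k s t, p k s t → s ≠ t)
    (hfun : ∀ k s t t', p k s t → p k s t' → t = t')
    (hone : ∀ k k' s t, p k s t → p k' s t → k = k')
    (hclosed : ∀ S ⊆ T, S.Nonempty → (∀ s ∈ S, ∀ k t, p k s t → t ∈ S) → S = T) :
    (∃ (n : ℕ) (f : ℤ → α) (c : ℤ → Bool), 2 ≤ n ∧ IsAlternatingOrder p (Set.Ico 0 (n : ℤ)) f c) ∨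
      ∃ (m : ℕ) (f : ZMod m → α) (c : ZMod m → Bool), Even m ∧ 4 ≤ m ∧
        IsAlternatingOrder p Set.univ f c := by
  classical
  have hTfin : T.Finite := Set.finite_of_ncard_pos (by omega)
  let Q : ℕ → Prop := fun n => ∃ f : ℕ → α, (∀ i ≤ n, f i ∈ T) ∧ Set.InjOn f (Set.Iic n) ∧
    ∀ i < n, ∃ k, p k (f i) (f (i + 1))
  have hcard : ∀ (n : ℕ) (f : ℕ → α), Set.InjOn f (Set.Iic n) → (f '' Set.Iic n).ncard = n + 1 := by
    intro n f hf
    rw [hf.ncard_image, ← Finset.coe_Iic, Set.ncard_coe_finset, Nat.card_Iic]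
  have hQ : ∀ n, Q n → n + 1 ≤ T.ncard := by
    rintro n ⟨f, hf, hinj, -⟩
    rw [← hcard n f hinj]
    refine Set.ncard_le_ncard ?_ hTfin
    rintro _ ⟨i, hi, rfl⟩
    exact hf i hi
  have hQ0 : Q 0 := by
    obtain ⟨t, ht⟩ : T.Nonempty := Set.nonempty_of_ncard_ne_zero (by omega)
    refine ⟨fun _ => t, fun _ _ => ht, ?_, by simp⟩
    intro i hi j hj _
    simp only [Set.mem_Iic, Nat.le_zero] at hi hj
    rw [hi, hj]
  set n := Nat.findGreatest Q T.ncard with hn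
  obtain ⟨f, hfT, hinj, hadj⟩ : Q n := Nat.findGreatest_spec (Nat.zero_le _) hQ0
  have hmax : ¬ Q (n + 1) := fun h => by
    have := Nat.le_findGreatest (n := T.ncard) (by have := hQ _ h; omega) h
    omega
  choose! c hc using hadj
  have hinj' : ∀ {i j}, i ≤ n → j ≤ n → f i = f j → i = j := fun hi hj h => hinj hi hj h
  -- a longest path cannot be prolonged at either end
  have hend : ∀ k t, p k (f n) t → ∃ i ≤ n, t = f i := by
    intro k t ht
    by_contra! hcon
    refine hmax ⟨fun i => if i ≤ n then f i else t, fun i hi => ?_, ?_, fun i hi => ?_⟩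
    · by_cases h : i ≤ n
      · simpa [h] using hfT i h
      · simpa [h] using hmem _ _ _ (hsymm _ _ _ ht)
    · intro i hi j hj hij
      rw [Set.mem_Iic] at hi hj
      by_cases h : i ≤ n <;> by_cases h' : j ≤ n <;> simp only [h, h', if_true, if_false] at hij
      · exact hinj' h h' hij
      · exact absurd hij.symm (hcon i h)
      · exact absurd hij (hcon j h')
      · omega
    · rcases Nat.lt_succ_iff_lt_or_eq.1 hi with hi | rfl
      · exact ⟨c i, by simpa [hi.le, Nat.succ_le_of_lt hi] using hc i hi⟩
      · exact ⟨k, by simpa using ht⟩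
  have hstart : ∀ k t, p k (f 0) t → ∃ i ≤ n, t = f i := by
    intro k t ht
    by_contra! hcon
    refine hmax ⟨fun i => if i = 0 then t else f (i - 1), fun i hi => ?_, ?_, fun i hi => ?_⟩
    · by_cases h : i = 0
      · simpa [h] using hmem _ _ _ (hsymm _ _ _ ht)
      · simpa [h] using hfT (i - 1) (by omega)
    · intro i hi j hj hij
      rw [Set.mem_Iic] at hi hj
      by_cases h : i = 0 <;> by_cases h' : j = 0 <;> simp only [h, h', if_true, if_false] at hij
      · omega
      · exact absurd hij (hcon _ (by omega))
      · exact absurd hij.symm (hcon _ (by omega))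
      · have := hinj' (by omega) (by omega) hij
        omega
    · by_cases h : i = 0
      · subst h
        exact ⟨k, by simpa using hsymm _ _ _ ht⟩
      · have := hc (i - 1) (by omega)
        rw [Nat.sub_add_cancel (by omega)] at this
        exact ⟨_, by simpa [h] using this⟩
  have halt : ∀ i, i + 1 < n → c (i + 1) ≠ c i := by
    intro i hi heq
    have h1 := hc (i + 1) hi
    rw [heq] at h1
    have := hinj' (by omega) (by omega) (hfun _ _ _ _ (hsymm _ _ _ (hc i (by omega))) h1)
    omega
  have hbool : ∀ {x y : Bool} (k : Bool), x ≠ y → k = x ∨ k = y := by decide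
  have hcov : ∀ i, i + 1 < n → ∀ k, k = c i ∨ k = c (i + 1) := fun i hi k =>
    (hbool k (halt i hi)).symm
  have hmid : ∀ i, i + 1 < n → ∀ k t, p k (f (i + 1)) t → t = f i ∨ t = f (i + 2) := by
    intro i hi k t ht
    rcases hcov i hi k with rfl | rfl
    · exact .inl (hfun _ _ _ _ ht (hsymm _ _ _ (hc i (by omega))))
    · exact .inr (hfun _ _ _ _ ht (hc (i + 1) hi))
  have hrange : f '' Set.Iic n = T := by
    refine hclosed _ ?_ ⟨f 0, 0, by simp, rfl⟩ ?_
    · rintro _ ⟨i, hi, rfl⟩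
      exact hfT i hi
    · rintro _ ⟨i, hi, rfl⟩ k t ht
      rw [Set.mem_Iic] at hi
      have : ∃ j ≤ n, t = f j := by
        rcases i with _ | i
        · exact hstart k t ht
        · rcases Nat.lt_or_eq_of_le hi with hi | hi
          · rcases hmid i hi k t ht with rfl | rfl
            · exact ⟨i, by omega, rfl⟩
            · exact ⟨i + 2, by omega, rfl⟩
          · rw [hi] at ht
            exact hend k t ht
      obtain ⟨j, hj, rfl⟩ := this
      exact ⟨j, hj, rfl⟩
  have hn2 : 2 ≤ n := by
    have := hcard n f hinj
    rw [hrange] at this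
    omega
  have hidx : ∀ k s t, p k s t → ∃ i ≤ n, s = f i := by
    intro k s t h
    have := hmem k s t h
    rw [← hrange] at this
    obtain ⟨i, hi, rfl⟩ := this
    exact ⟨i, hi, rfl⟩
  by_cases hclose : ∃ k, p k (f n) (f 0)
  · right
    obtain ⟨k, hk⟩ := hclose
    let c' : ℕ → Bool := fun i => if i < n then c i else k
    have hc' : ∀ i, i < n → c' i = c i := fun i hi => by simp [c', hi]
    have hcn : c' n = k := by simp [c']
    have halt' : ∀ i < n, c' (i + 1) ≠ c' i := by
      intro i hi
      rw [hc' i hi]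
      rcases Nat.lt_or_eq_of_le (Nat.succ_le_of_lt hi) with h | h
      · rw [hc' _ h]
        exact halt i h
      · rw [Nat.succ_eq_add_one] at h
        rw [h, hcn]
        rintro rfl
        have h1 := hsymm _ _ _ (hc i hi)
        rw [h] at h1
        have := hinj' (by omega) (by omega) (hfun _ _ _ _ h1 hk)
        omega
    have hlast : c' 0 ≠ c' n := by
      rw [hcn, hc' 0 (by omega)]
      rintro rfl
      have := hinj' (by omega) (by omega) (hfun _ _ _ _ (hsymm _ _ _ hk) (hc 0 (by omega)))
      omega
    have hpar : ∀ i ≤ n, (c' i = c' 0 ↔ Even i) := by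
      intro i hi
      induction i with
      | zero => simp
      | succ i ih =>
        have h1 := halt' i (by omega)
        rw [Nat.even_add_one, ← ih (by omega)]
        revert h1
        generalize c' (i + 1) = x
        generalize c' i = y
        generalize c' 0 = z
        revert x y z
        decide
    have heven : Even (n + 1) := by
      rw [Nat.even_add_one, ← hpar n le_rfl]
      exact hlast.symm
    have hp : ∀ i : ZMod (n + 1), p (c' i.val) (f i.val) (f (i + 1).val) := by
      intro i
      rcases zmod_add_one_cases i with ⟨h, h'⟩ | ⟨h, h'⟩
      · rw [h', hc' _ h]
        exact hc _ h
      · rw [h', h, hcn, ZMod.val_zero]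
        exact hk
    have ha : ∀ i : ZMod (n + 1), c' (i + 1).val ≠ c' i.val := by
      intro i
      rcases zmod_add_one_cases i with ⟨h, h'⟩ | ⟨h, h'⟩
      · rw [h']
        exact halt' _ h
      · rw [h', h, ZMod.val_zero]
        exact hlast
    have hi : ∀ i j : ZMod (n + 1), f i.val = f j.val → i = j := fun i j h =>
      ZMod.val_injective _ (hinj' (Nat.lt_succ_iff.1 (ZMod.val_lt i))
        (Nat.lt_succ_iff.1 (ZMod.val_lt j)) h)
    refine ⟨n + 1, fun i => f i.val, fun i => c' i.val, heven, ?_, fun i _ => hp i, fun i _ _ => ha i,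
      fun i _ j _ h => hi i j h, fun i _ j _ h => hi i (j + 1) h,
      fun i _ j _ h => add_right_cancel (hi (i + 1) (j + 1) h), fun k' s t h => ?_⟩
    · obtain ⟨r, hr⟩ := heven
      omega
    · obtain ⟨i, hin, rfl⟩ := hidx k' s t h
      have hval : ((i : ℕ) : ZMod (n + 1)).val = i := ZMod.val_cast_of_lt (by omega)
      have h2 := ha ((i : ZMod (n + 1)) - 1)
      rw [sub_add_cancel, hval] at h2
      rcases hbool k' h2 with rfl | rfl
      · exact ⟨i, trivial, by simp only [hval], .inl (by simp only [hval])⟩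
      · exact ⟨(i : ZMod (n + 1)) - 1, trivial, rfl, .inr (by simp only [sub_add_cancel, hval])⟩
  · left
    have hnat : ∀ i ∈ Set.Ico 0 (n : ℤ), ∃ j : ℕ, i = j ∧ j < n := by
      rintro i ⟨h0, hlt⟩
      lift i to ℕ using h0
      exact ⟨i, rfl, by omega⟩
    have htn : ∀ j : ℕ, ((j : ℤ) + 1).toNat = j + 1 := fun j => by omega
    refine ⟨n, fun i => f i.toNat, fun i => c i.toNat, hn2, fun i hi => ?_, fun i hi hi' => ?_,
      fun i hi j hj h => ?_, fun i hi j hj h => ?_, fun i hi j hj h => ?_, fun k s t h => ?_⟩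
    · obtain ⟨i, rfl, hin⟩ := hnat i hi
      simpa only [htn, Int.toNat_natCast] using hc i hin
    · obtain ⟨i, rfl, hi⟩ := hnat i hi
      simpa only [htn, Int.toNat_natCast] using halt i (by have := hi'.2; omega)
    · obtain ⟨i, rfl, hin⟩ := hnat i hi
      obtain ⟨j, rfl, hjn⟩ := hnat j hj
      simp only [Int.toNat_natCast] at h
      rw [hinj' hin.le hjn.le h]
    · obtain ⟨i, rfl, hin⟩ := hnat i hi
      obtain ⟨j, rfl, hjn⟩ := hnat j hj
      simp only [htn, Int.toNat_natCast] at h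
      rw [hinj' hin.le hjn h]
      simp
    · obtain ⟨i, rfl, hin⟩ := hnat i hi
      obtain ⟨j, rfl, hjn⟩ := hnat j hj
      simp only [htn] at h
      have := hinj' hin hjn h
      omega
    · have hwit : ∀ i < n, c i = k → (s = f i ∨ s = f (i + 1)) → ∃ i ∈ Set.Ico 0 (n : ℤ),
          c i.toNat = k ∧ (s = f i.toNat ∨ s = f (i + 1).toNat) := fun i hi hk hs =>
        ⟨i, ⟨by omega, by omega⟩, by simpa using hk, by simpa only [htn, Int.toNat_natCast] using hs⟩
      obtain ⟨i, hi, rfl⟩ := hidx k s t h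
      obtain ⟨j, hj, rfl⟩ := hidx k t _ (hsymm _ _ _ h)
      -- an end of the path has only its neighbour on the path as a partner
      rcases i with _ | i
      · have hj1 : j = 1 := by
          rcases j with _ | j
          · exact absurd rfl (hne _ _ _ h)
          · rcases Nat.lt_or_eq_of_le hj with hj' | hj'
            · rcases hmid j hj' k _ (hsymm _ _ _ h) with h' | h'
              · have := hinj' (by omega) (by omega) h'
                omega
              · have := hinj' (by omega) (by omega) h'
                omega
            · rw [hj'] at h
              exact absurd ⟨k, hsymm _ _ _ h⟩ hclose
        subst hj1
        exact hwit 0 (by omega) (hone _ _ _ _ (hc 0 (by omega)) h) (.inl rfl)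
      · rcases Nat.lt_or_eq_of_le hi with hi' | hi'
        · rcases hcov i hi' k with rfl | rfl
          · exact hwit i (by omega) rfl (.inr rfl)
          · exact hwit (i + 1) hi' rfl (.inl rfl)
        · have hji : j = i := by
            rcases j with _ | j
            · rw [hi'] at h
              exact absurd ⟨k, h⟩ hclose
            · have hj' : j + 1 < n := by
                refine Nat.lt_of_le_of_ne hj fun h' => hne _ _ _ h ?_
                rw [hi', h']
              rcases hmid j hj' k _ (hsymm _ _ _ h) with h' | h'
              · have := hinj' (by omega) (by omega) h'
                omega
              · have := hinj' (by omega) (by omega) h'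
                omega
          subst hji
          exact hwit j (by omega) (hone _ _ _ _ (hsymm _ _ _ (hc j (by omega))) h) (.inr rfl)

end Enumeration

/-! ### Cyclic decompositions and good colourings -/

section Decompositions

variable {α β : Type*} {G : Graph α β} {T : Set α} {col : β → Bool}

/-- Bags of the same colour are disjoint, so giving each edge the colour of a bag that contains its
ends is a good colouring. -/
lemma IsCyclicDecomposition.exists_isGoodColouring {γ δ : Type*} {H : Graph γ δ} {B : γ → Set α}
    (hD : IsCyclicDecomposition G T H B) (hV : V(G).Finite) : ∃ col, IsGoodColouring G T col := by
  obtain ⟨c, hc⟩ := hD.bipartite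
  have hBV : ∀ x ∈ V(H), B x ⊆ V(G) := fun x hx v hv => by
    rw [← hD.iUnion_eq]
    exact Set.mem_biUnion hx hv
  have hex : ∀ e, ∃ k, e ∈ E(G) → ∃ x ∈ V(H), c x = k ∧ ∀ v, G.Inc e v → v ∈ B x := by
    intro e
    by_cases he : e ∈ E(G)
    · obtain ⟨a, b, hl⟩ := G.exists_isLink_of_mem_edgeSet he
      obtain ⟨x, hx, ha, hb⟩ := hD.adj_mem a b hl.adj
      refine ⟨c x, fun _ => ⟨x, hx, rfl, fun v hv => ?_⟩⟩
      rcases hv.eq_or_eq_of_isLink hl with rfl | rfl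
      · exact ha
      · exact hb
    · exact ⟨true, fun h => absurd h he⟩
  choose col hcol using hex
  have hsame : ∀ x ∈ V(H), ∀ y ∈ V(H), c x = c y → ∀ z, z ∈ B x → z ∈ B y → x = y := by
    intro x hx y hy hxy z hzx hzy
    by_contra hne
    have h1 := hD.ncard_inter x hx y hy hne
    have h2 : {f | H.IsLink f x y} = ∅ := by
      ext f
      simp only [Set.mem_ofPred_eq, Set.mem_empty_iff_false, iff_false]
      exact fun hf => hc x y hf.adj hxy
    rw [h2, Set.ncard_empty, Set.ncard_eq_zero ((hV.subset (hBV x hx)).subset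
      Set.inter_subset_left)] at h1
    exact Set.notMem_empty z (h1 ▸ ⟨hzx, hzy⟩)
  refine ⟨col, fun v hvT e e' he he' => ?_, fun k u => ?_⟩
  · obtain ⟨x, hx, hxk, hxe⟩ := hcol e he.edge_mem
    obtain ⟨y, hy, hyk, hye⟩ := hcol e' he'.edge_mem
    by_contra hne
    refine hvT (hD.inter_subset x hx y hy ?_ ⟨hxe v he, hye v he'⟩)
    rintro rfl
    exact hne (hxk.symm.trans hyk)
  · have key : ∀ t, Joined G (colourClass G col k) u t →
        t = u ∨ ∃ x ∈ V(H), c x = k ∧ u ∈ B x ∧ t ∈ B x := by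
      intro t ht
      refine ht.mem_of_closed (S := {t | t = u ∨ ∃ x ∈ V(H), c x = k ∧ u ∈ B x ∧ t ∈ B x}) ?_
        (.inl rfl)
      rintro e ⟨he, hek⟩ a b hl ha
      obtain ⟨y, hy, hyk, hye⟩ := hcol e he
      rcases ha with rfl | ⟨x, hx, hxk, hux, hax⟩
      · exact .inr ⟨y, hy, hyk.trans hek, hye _ hl.inc_left, hye _ hl.inc_right⟩
      · have := hsame x hx y hy (hxk.trans (hyk.trans hek).symm) a hax (hye _ hl.inc_left)
        subst this
        exact .inr ⟨x, hx, hxk, hux, hye _ hl.inc_right⟩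
    by_cases hu : ∃ x ∈ V(H), c x = k ∧ u ∈ B x
    · obtain ⟨x, hx, hxk, hux⟩ := hu
      refine le_trans (Set.ncard_le_ncard ?_ ((hV.subset (hBV x hx)).subset
        Set.inter_subset_right)) (hD.ncard_le x hx)
      rintro t ⟨ht, htT⟩
      rcases key t ht with rfl | ⟨y, hy, hyk, huy, hty⟩
      · exact ⟨htT, hux⟩
      · rw [hsame x hx y hy (hxk.trans hyk.symm) u hux huy]
        exact ⟨htT, hty⟩
    · refine le_trans (Set.ncard_le_ncard (t := {u}) ?_) (by simp)
      rintro t ⟨ht, -⟩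
      rcases key t ht with rfl | ⟨y, hy, hyk, huy, -⟩
      · rfl
      · exact absurd ⟨y, hy, hyk, huy⟩ hu

/-- Distinct vertices `s, t ∈ T` are partners in the colour `c` if they lie in the same component of
the edges of this colour. -/
def Partner (G : Graph α β) (T : Set α) (col : β → Bool) (c : Bool) (s t : α) : Prop :=
  s ∈ T ∧ t ∈ T ∧ s ≠ t ∧ Joined G (colourClass G col c) s t

lemma Joined.exists_inc {F : Set β} {u v : α} (h : Joined G F u v) (huv : u ≠ v) :
    ∃ e ∈ F, G.Inc e v := by
  rcases Relation.ReflTransGen.cases_tail h with h' | ⟨w, _, e, he, hl⟩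
  · exact absurd h'.symm huv
  · exact ⟨e, he, hl.inc_right⟩

lemma Partner.symm {c : Bool} {s t : α} (h : Partner G T col c s t) : Partner G T col c t s :=
  ⟨h.2.1, h.1, h.2.2.1.symm, h.2.2.2.symm⟩

lemma IsGoodColouring.eq_or_eq (hcol : IsGoodColouring G T col) (hT : T.Finite) {c : Bool}
    {s t v : α} (h : Partner G T col c s t) (hv : v ∈ T)
    (hsv : Joined G (colourClass G col c) s v) : v = s ∨ v = t := by
  by_contra! hne
  have h1 := hcol.ncard_le c s
  have h2 : 2 < {t | Joined G (colourClass G col c) s t ∧ t ∈ T}.ncard :=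
    (Set.two_lt_ncard_iff (hT.subset fun x hx => hx.2)).2
      ⟨s, t, v, ⟨.refl _, h.1⟩, ⟨h.2.2.2, h.2.1⟩, ⟨hsv, hv⟩, h.2.2.1, hne.1.symm, hne.2.symm⟩
  omega

/-- If a walk of colour `k` ends in a vertex outside `T` different from its start, then every edge at
this vertex has the colour `k`. -/
lemma IsGoodColouring.joined_step (hcol : IsGoodColouring G T col) {k : Bool} {s v y : α} {e : β}
    (h : Joined G (colourClass G col k) s v) (hsv : s ≠ v) (hv : v ∉ T) (hl : G.IsLink e v y) :
    Joined G (colourClass G col k) s y := by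
  obtain ⟨e', he', hinc⟩ := h.exists_inc hsv
  have := hcol.mono v hv e e' hl.inc_left hinc
  exact h.trans (.of_link ⟨hl.edge_mem, this.trans he'.2⟩ hl)

/-- Every vertex incident with an edge of colour `c` has two vertices of `T` in its component of the
edges of this colour: a component with fewer would be pendant. -/
lemma IsGoodColouring.exists_partner (hcol : IsGoodColouring G T col)
    (hG : ∀ v, ¬ IsIsolated G v) (hT : T ⊆ V(G)) (hT3 : 3 ≤ T.ncard)
    (hcon : ∀ u ∈ V(G), ∀ v ∈ V(G), Joined G E(G) u v) (hins : Inseparable G T)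
    (hloop : ∀ e a, ¬ G.IsLink e a a) {c : Bool} {e : β} {a b : α} (hl : G.IsLink e a b)
    (he : col e = c) : ∃ s t, Partner G T col c s t ∧ Joined G (colourClass G col c) a s := by
  have hne : T.Nonempty := Set.nonempty_of_ncard_ne_zero (by omega)
  have heC : e ∈ colourClass G col c := ⟨hl.edge_mem, he⟩
  set D : Set α := {z | Joined G (colourClass G col c) a z} with hD
  have hstep : ∀ z ∈ D, z ∉ T → ∀ f y, G.IsLink f z y → y ∈ D := by
    intro z hz hzT f y hf
    by_cases haz : a = z
    · subst haz
      exact .of_link ⟨hf.edge_mem, (hcol.mono _ hzT f e hf.inc_left hl.inc_left).trans he⟩ hf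
    · exact hcol.joined_step hz haz hzT hf
  obtain ⟨s, hsD, hsT⟩ : ∃ s ∈ D, s ∈ T := by
    by_contra! hcon'
    obtain ⟨t, ht⟩ := hne
    have := (hcon a hl.left_mem t (hT ht)).mem_of_closed (S := D)
      (fun f _ p q hpq hp => hstep p hp (hcon' p hp) f q hpq) (.refl _)
    exact hcon' t this ht
  by_contra! hno
  have honly : ∀ t ∈ D, t ∈ T → t = s := by
    intro t htD htT
    by_contra hts
    exact hno s t ⟨hsT, htT, fun h => hts h.symm, Joined.trans (Joined.symm hsD) htD⟩ hsD
  obtain ⟨t, htT, hts⟩ := Set.exists_ne_of_one_lt_ncard (s := T) (by omega) s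
  have htD : t ∉ D := fun h => hts (honly t h htT)
  obtain ⟨f, y, hf⟩ : ∃ f y, G.IsLink f t y := by
    by_contra! hcon'
    exact hG t ⟨hT htT, fun f ⟨y, hy⟩ => hcon' f y hy⟩
  have hyW : y ∉ D \ {s} := fun h =>
    htD (hstep y h.1 (fun hyT => h.2 (honly y h.1 hyT)) f t hf.symm)
  obtain ⟨a', b', hl', ha'⟩ : ∃ a' b', G.IsLink e a' b' ∧ a' ∈ D \ {s} := by
    by_cases has : a = s
    · refine ⟨b, a, hl.symm, Joined.of_link heC hl, fun hbs => hloop e a ?_⟩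
      rw [Set.mem_singleton_iff] at hbs
      rw [hbs, ← has] at hl
      exact hl
    · exact ⟨a, b, hl, Joined.refl _, has⟩
  refine hins.no_pendant hcon hT hne (W := D \ {s}) (v := s) (fun h => h.2 rfl)
    (fun w hw hwT => hw.2 (honly w hw.1 hwT)) (fun g p q hpq hp => ?_) hl' ha' hf
    (fun h => htD h.1) hyW
  by_cases hqs : q = s
  · exact .inr hqs
  · exact .inl ⟨hstep p hp.1 (fun h => hp.2 (honly p hp.1 h)) g q hpq, hqs⟩

/-- The path or cycle with vertex set `S` in which `e` joins `e` to `e + 1`. -/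
def successorGraph {I : Type} [CommRing I] (S : Set I) : Graph I I where
  vertexSet := S
  edgeSet := {e | e ∈ S ∧ e + 1 ∈ S}
  IsLink e x y := e ∈ S ∧ e + 1 ∈ S ∧ ((x = e ∧ y = e + 1) ∨ (x = e + 1 ∧ y = e))
  isLink_symm e _ := ⟨fun x y h => ⟨h.1, h.2.1, h.2.2.symm.imp And.symm And.symm⟩⟩
  eq_or_eq_of_isLink_of_isLink := by
    rintro e x y v w ⟨-, -, ⟨rfl, rfl⟩ | ⟨rfl, rfl⟩⟩ ⟨-, -, ⟨rfl, rfl⟩ | ⟨rfl, rfl⟩⟩ <;> simp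
  edge_mem_iff_exists_isLink e :=
    ⟨fun h => ⟨e, e + 1, h.1, h.2, .inl ⟨rfl, rfl⟩⟩, fun ⟨_, _, h⟩ => ⟨h.1, h.2.1⟩⟩
  left_mem_of_isLink := by
    rintro e x y ⟨h, h', ⟨rfl, rfl⟩ | ⟨rfl, rfl⟩⟩
    · exact h
    · exact h'

lemma degree_successorGraph_le {I : Type} [CommRing I] (h1 : (1 : I) ≠ 0) (S : Set I) (x : I) :
    degree (successorGraph S) x ≤ 2 := by
  have hloop : (successorGraph S).loopSet x = ∅ := by
    ext e
    simp only [Graph.mem_loopSet, Set.mem_empty_iff_false, iff_false]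
    rintro ⟨-, -, ⟨rfl, h⟩ | ⟨h, rfl⟩⟩
    · exact h1 (left_eq_add.1 h)
    · exact h1 (left_eq_add.1 h)
  have hinc : (successorGraph S).incidenceSet x ⊆ {x, x - 1} := by
    rintro e ⟨y, -, -, ⟨rfl, -⟩ | ⟨rfl, -⟩⟩
    · exact .inl rfl
    · exact .inr (by simp)
  rw [degree, hloop, Set.ncard_empty, add_zero]
  exact (Set.ncard_le_ncard hinc).trans ((Set.ncard_insert_le _ _).trans (by simp))

/-- The bags are the components of the two colour classes, in the order in which they follow one
another along the partners. -/
lemma IsGoodColouring.isNiceCyclicDecomposition (hcol : IsGoodColouring G T col)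
    (hG : ∀ v, ¬ IsIsolated G v) (hTfin : T.Finite) (hT : T ⊆ V(G))
    (hpart : ∀ e a b, G.IsLink e a b → ∃ s t, Partner G T col (col e) s t ∧
      Joined G (colourClass G col (col e)) a s)
    {I : Type} [CommRing I] (h2 : (2 : I) ≠ 0) {S : Set I} (hS : S.Finite) {f : I → α}
    {c : I → Bool} (ho : IsAlternatingOrder (Partner G T col) S f c) :
    IsNiceCyclicDecomposition G T (successorGraph S)
      (fun i => {v | Joined G (colourClass G col (c i)) (f i) v}) := by
  have h1 : (1 : I) ≠ 0 := by
    intro h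
    apply h2
    rw [← one_add_one_eq_two, h, add_zero]
  set B : I → Set α := fun i => {v | Joined G (colourClass G col (c i)) (f i) v} with hB
  have hfT : ∀ i ∈ S, f i ∈ T := fun i hi => (ho.partner i hi).1
  have hfT' : ∀ i ∈ S, f (i + 1) ∈ T := fun i hi => (ho.partner i hi).2.1
  have hfB : ∀ i, f i ∈ B i := fun i => .refl _
  have hfB' : ∀ i ∈ S, f (i + 1) ∈ B i := fun i hi => (ho.partner i hi).2.2.2
  have hBT : ∀ i ∈ S, ∀ v ∈ B i, v ∈ T → v = f i ∨ v = f (i + 1) := fun i hi v hv hvT =>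
    hcol.eq_or_eq hTfin (ho.partner i hi) hvT hv
  have hinter : ∀ i ∈ S, ∀ j ∈ S, i ≠ j → ∀ v ∈ B i, v ∈ B j →
      v ∈ T ∧ ((v = f j ∧ j = i + 1) ∨ (v = f i ∧ i = j + 1)) := by
    intro i hi j hj hij v hvi hvj
    have hc : c i ≠ c j := by
      intro hc
      -- otherwise both bags are the same component, with the vertices `f i, f (i + 1)` in `T`
      have h3 : f j ∈ B i := by
        change Joined G _ (f j) v at hvj
        rw [← hc] at hvj
        exact Joined.trans hvi hvj.symm
      rcases hBT i hi _ h3 (hfT j hj) with h4 | h4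
      · exact hij (ho.inj _ hj _ hi h4).symm
      · have h5 := ho.inj_succ _ hj _ hi h4
        exact ho.alternate i hi (h5 ▸ hj) (h5 ▸ hc.symm)
    have hvT : v ∈ T := by
      by_contra hvT
      obtain ⟨e, he, hev⟩ := Joined.exists_inc hvi fun h => hvT (h ▸ hfT i hi)
      obtain ⟨e', he', hev'⟩ := Joined.exists_inc hvj fun h => hvT (h ▸ hfT j hj)
      exact hc (he.2.symm.trans ((hcol.mono v hvT e e' hev hev').trans he'.2))
    refine ⟨hvT, ?_⟩
    rcases hBT i hi v hvi hvT with h | h <;> rcases hBT j hj v hvj hvT with h' | h'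
    · exact absurd (ho.inj _ hi _ hj (h.symm.trans h')) hij
    · exact .inr ⟨h, ho.inj_succ _ hi _ hj (h.symm.trans h')⟩
    · exact .inl ⟨h', ho.inj_succ _ hj _ hi (h'.symm.trans h)⟩
    · exact absurd (ho.inj_succ_succ _ hi _ hj (h.symm.trans h')) hij
  have hcover : ∀ e a b, G.IsLink e a b → ∃ i ∈ S, c i = col e ∧ a ∈ B i ∧ b ∈ B i := by
    intro e a b hl
    obtain ⟨s, t, hst, has⟩ := hpart e a b hl
    obtain ⟨i, hi, hci, hs⟩ := ho.cover _ _ _ hst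
    have hsB : s ∈ B i := by
      rcases hs with rfl | rfl
      · exact hfB i
      · exact hfB' i hi
    have haB : a ∈ B i := Joined.trans hsB (hci ▸ has.symm)
    exact ⟨i, hi, hci, haB, Joined.trans haB (.of_link ⟨hl.edge_mem, hci.symm⟩ hl)⟩
  have hBV : ∀ i ∈ S, B i ⊆ V(G) := fun i hi v hv => Joined.mem hv (hT (hfT i hi))
  have hsucc : ∀ i ∈ S, i + 1 ∈ S →
      (B i ∩ B (i + 1)).ncard = {e | (successorGraph S).IsLink e i (i + 1)}.ncard := by
    intro i hi hi'
    have h3 : B i ∩ B (i + 1) = {f (i + 1)} := by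
      ext v
      constructor
      · rintro ⟨hv, hv'⟩
        rcases (hinter i hi _ hi' (fun h => h1 (left_eq_add.1 h)) v hv hv').2 with ⟨h, -⟩ | ⟨-, h⟩
        · exact h
        · rw [add_assoc, left_eq_add, one_add_one_eq_two] at h
          exact absurd h h2
      · rintro rfl
        exact ⟨hfB' i hi, hfB (i + 1)⟩
    have h4 : {e | (successorGraph S).IsLink e i (i + 1)} = {i} := by
      ext e
      constructor
      · rintro ⟨-, -, ⟨h, -⟩ | ⟨h, h'⟩⟩
        · exact h.symm
        · rw [← h', add_assoc, left_eq_add, one_add_one_eq_two] at h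
          exact absurd h h2
      · rintro rfl
        exact ⟨hi, hi', .inl ⟨rfl, rfl⟩⟩
    rw [h3, h4, Set.ncard_singleton, Set.ncard_singleton]
  refine
    { vertexSet_finite := hS
      edgeSet_finite := hS.subset fun e he => he.1
      bipartite := ?_
      degree_le := fun x _ => degree_successorGraph_le h1 S x
      iUnion_eq := ?_
      adj_mem := ?_
      inter_subset := fun i hi j hj hij v hv => (hinter i hi j hj hij v hv.1 hv.2).1
      ncard_inter := ?_
      ncard_le := ?_
      bag_connected := ?_
      isolated := ?_ }
  · refine ⟨c, ?_⟩
    rintro x y ⟨e, he, he', ⟨rfl, rfl⟩ | ⟨rfl, rfl⟩⟩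
    · exact (ho.alternate _ he he').symm
    · exact ho.alternate _ he he'
  · refine subset_antisymm (Set.iUnion₂_subset hBV) fun v hv => ?_
    obtain ⟨e, w, hl⟩ : ∃ e w, G.IsLink e v w := by
      by_contra! hcon
      exact hG v ⟨hv, fun e ⟨w, hw⟩ => hcon e w hw⟩
    obtain ⟨i, hi, -, hvi, -⟩ := hcover e v w hl
    exact Set.mem_biUnion (t := B) hi hvi
  · rintro u v ⟨e, hl⟩
    obtain ⟨i, hi, -, h⟩ := hcover e u v hl
    exact ⟨i, hi, h⟩
  · intro i hi j hj hij
    by_cases h3 : j = i + 1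
    · subst h3
      exact hsucc i hi hj
    by_cases h4 : i = j + 1
    · subst h4
      rw [Set.inter_comm, hsucc j hj hi]
      congr 1
      ext e
      exact Graph.isLink_comm (G := successorGraph S)
    · have h5 : B i ∩ B j = ∅ := by
        ext v
        simp only [Set.mem_inter_iff, Set.mem_empty_iff_false, iff_false]
        rintro ⟨hv, hv'⟩
        rcases (hinter i hi j hj hij v hv hv').2 with ⟨-, h⟩ | ⟨-, h⟩
        · exact h3 h
        · exact h4 h
      have h6 : {e | (successorGraph S).IsLink e i j} = ∅ := by
        ext e
        simp only [Set.mem_ofPred_eq, Set.mem_empty_iff_false, iff_false]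
        rintro ⟨-, -, ⟨rfl, h⟩ | ⟨h, rfl⟩⟩
        · exact h3 h
        · exact h4 h
      rw [h5, h6, Set.ncard_empty, Set.ncard_empty]
  · intro i hi
    have : T ∩ B i ⊆ {f i, f (i + 1)} := fun v hv => hBT i hi v hv.2 hv.1
    exact (Set.ncard_le_ncard this).trans ((Set.ncard_insert_le _ _).trans (by simp))
  · refine fun i hi => ⟨⟨f i, hfB i⟩, fun x hx y hy => ?_⟩
    rw [reflTransGen_adj_iff]
    have hxy : Joined G (colourClass G col (c i)) x y := Joined.trans (Joined.symm hx) hy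
    have := hxy.of_closed (S := B i) (F' := {e | ∃ a b, (G.induce (B i)).IsLink e a b})
      (fun e he a b hl ha => by
        have hb : b ∈ B i := Joined.trans ha (.of_link he hl)
        exact ⟨hb, a, b, hl, ha, hb⟩) hx
    refine this.map id fun e he a b hl => ?_
    obtain ⟨p, q, hpq⟩ := he
    refine .of_link hpq.edge_mem ?_
    rcases hl.eq_and_eq_or_eq_and_eq hpq.1 with ⟨rfl, rfl⟩ | ⟨rfl, rfl⟩
    · exact hpq
    · exact hpq.symm
  · intro i hi hle
    exfalso
    have h3 : ({f i, f (i + 1)} : Set α) ⊆ B i ∩ T := by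
      rintro v (rfl | rfl)
      · exact ⟨hfB i, hfT i hi⟩
      · exact ⟨hfB' i hi, hfT' i hi⟩
    have h4 := Set.ncard_le_ncard h3 (hTfin.subset Set.inter_subset_right)
    rw [Set.ncard_pair (ho.partner i hi).2.2.1] at h4
    omega

end Decompositions

/-! ### The characterization -/

section Characterization

variable {α β : Type*} {G : Graph α β} {T : Set α} {col : β → Bool}

lemma isCycleGraph_successorGraph {m : ℕ} (hm : 1 ≤ m) :
    IsCycleGraph (successorGraph (Set.univ : Set (ZMod m))) m :=
  ⟨hm, id, id, Function.injective_id, Function.injective_id, Set.range_id.symm,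
    by rw [Set.range_id]; exact Set.eq_univ_of_forall fun _ => ⟨trivial, trivial⟩,
    fun _ => ⟨trivial, trivial, .inl ⟨rfl, rfl⟩⟩⟩

lemma isPathGraph_successorGraph (n : ℕ) :
    IsPathGraph (successorGraph (Set.Ico 0 ((n + 1 : ℕ) : ℤ))) n := by
  have hmem : ∀ i : ℕ, i < n + 1 → (i : ℤ) ∈ Set.Ico 0 ((n + 1 : ℕ) : ℤ) := fun i hi =>
    ⟨Int.natCast_nonneg i, Int.ofNat_lt.2 hi⟩
  have hmem' : ∀ i : ℕ, i < n → (i : ℤ) + 1 ∈ Set.Ico 0 ((n + 1 : ℕ) : ℤ) := fun i hi => by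
    exact_mod_cast hmem (i + 1) (by omega)
  refine ⟨fun i => (i : ℕ), fun i => (i : ℕ), fun i j h => ?_, fun i j h => ?_, ?_, ?_, fun i => ?_⟩
  · exact Fin.ext (Int.ofNat.inj h)
  · exact Fin.ext (Int.ofNat.inj h)
  · ext z
    constructor
    · rintro ⟨h0, hz⟩
      lift z to ℕ using h0
      exact ⟨⟨z, by omega⟩, rfl⟩
    · rintro ⟨i, rfl⟩
      exact hmem _ i.2
  · ext z
    constructor
    · rintro ⟨⟨h0, -⟩, -, hz⟩
      lift z to ℕ using h0
      exact ⟨⟨z, by omega⟩, rfl⟩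
    · rintro ⟨i, rfl⟩
      exact ⟨hmem _ (i.2.trans (Nat.lt_succ_self n)), hmem' _ i.2⟩
  · exact ⟨hmem _ (i.2.trans (Nat.lt_succ_self n)), hmem' _ i.2, .inl ⟨rfl, by simp⟩⟩

/-- Two vertices of `T` are partners in one colour only: if they were so in both, no third vertex of
`T` could be reached from them. -/
lemma IsGoodColouring.partner_unique (hcol : IsGoodColouring G T col) (hT : T ⊆ V(G))
    (hT3 : 3 ≤ T.ncard) (hcon : ∀ u ∈ V(G), ∀ v ∈ V(G), Joined G E(G) u v) {k k' : Bool} {s t : α}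
    (h : Partner G T col k s t) (h' : Partner G T col k' s t) : k = k' := by
  by_contra hne
  have hTfin : T.Finite := Set.finite_of_ncard_pos (by omega)
  have hall : ∀ j, Partner G T col j s t := by
    intro j
    have hbool : ∀ a b c : Bool, a ≠ b → c = a ∨ c = b := by decide
    rcases hbool k k' j hne with rfl | rfl
    · exact h
    · exact h'
  have hst : ({s, t} : Set α).ncard < T.ncard := by
    rw [Set.ncard_pair h.2.2.1]
    omega
  obtain ⟨z, hzT, hz⟩ := Set.exists_mem_notMem_of_ncard_lt_ncard hst (Set.toFinite _)
  obtain ⟨j, hj⟩ := (hcon s (hT h.1) z (hT hzT)).mem_of_closed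
    (S := {v | ∃ j, Joined G (colourClass G col j) s v}) (by
      rintro e - v y hl ⟨j, hj⟩
      by_cases hvT : v ∈ T
      · have hv : Joined G (colourClass G col (col e)) s v := by
          rcases hcol.eq_or_eq hTfin (hall j) hvT hj with rfl | rfl
          · exact .refl _
          · exact (hall (col e)).2.2.2
        exact ⟨col e, hv.trans (.of_link ⟨hl.edge_mem, rfl⟩ hl)⟩
      · exact ⟨j, hcol.joined_step hj (fun hsv => hvT (hsv ▸ h.1)) hvT hl⟩) ⟨true, .refl _⟩
  exact hz (hcol.eq_or_eq hTfin (hall j) hzT hj)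

/-- All of `T` can be reached by steps from a vertex to a partner: a walk in `G` changes its colour
only at vertices in `T`. -/
lemma IsGoodColouring.eq_of_partner_closed (hcol : IsGoodColouring G T col) (hT : T ⊆ V(G))
    (hcon : ∀ u ∈ V(G), ∀ v ∈ V(G), Joined G E(G) u v) {S : Set α} (hST : S ⊆ T)
    (hne : S.Nonempty) (hS : ∀ s ∈ S, ∀ k t, Partner G T col k s t → t ∈ S) : S = T := by
  refine subset_antisymm hST fun t ht => ?_
  obtain ⟨s₀, hs₀⟩ := hne
  have hmem : ∀ s ∈ S, ∀ j, ∀ v ∈ T, Joined G (colourClass G col j) s v → v ∈ S := by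
    intro s hs j v hv hj
    by_cases hsv : s = v
    · exact hsv ▸ hs
    · exact hS s hs j v ⟨hST hs, hv, hsv, hj⟩
  obtain ⟨s, hs, j, hj⟩ := (hcon s₀ (hT (hST hs₀)) t (hT ht)).mem_of_closed
    (S := {v | ∃ s ∈ S, ∃ j, Joined G (colourClass G col j) s v}) (by
      rintro e - v y hl ⟨s, hs, j, hj⟩
      by_cases hvT : v ∈ T
      · exact ⟨v, hmem s hs j v hvT hj, col e, .of_link ⟨hl.edge_mem, rfl⟩ hl⟩
      · exact ⟨s, hs, j, hcol.joined_step hj (fun hsv => hvT (hsv ▸ hST hs)) hvT hl⟩)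
    ⟨s₀, hs₀, true, .refl _⟩
  exact hmem s hs j t ht hj

lemma Inseparable.not_isLink_self (hins : Inseparable G T) (hG : ∀ v, ¬ IsIsolated G v)
    (hT : T ⊆ V(G)) (hT2 : 1 < T.ncard) (e : β) (a : α) : ¬ G.IsLink e a a := by
  intro hl
  obtain ⟨t, ht, hta⟩ := Set.exists_ne_of_one_lt_ncard hT2 a
  obtain ⟨f, y, hf⟩ : ∃ f y, G.IsLink f t y := by
    by_contra! hcon
    exact hG t ⟨hT ht, fun f ⟨y, hy⟩ => hcon f y hy⟩
  rw [hins.eq_of_isLink_self hl hf.edge_mem] at hf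
  rcases hf.left_eq_or_eq hl with h | h
  · exact hta h
  · exact hta h

/-- A good colouring of an inseparable graft with `|T| ≥ 3` yields a nice cyclic decomposition along
a path or an even cycle. -/
lemma IsGoodColouring.exists_decomposition (hcol : IsGoodColouring G T col)
    (hG : ∀ v, ¬ IsIsolated G v) (hT : T ⊆ V(G)) (hT3 : 3 ≤ T.ncard)
    (hcon : ∀ u ∈ V(G), ∀ v ∈ V(G), Joined G E(G) u v) (hins : Inseparable G T) :
    (∃ (γ δ : Type) (H : Graph γ δ) (B : γ → Set α) (n : ℕ),
      IsNiceCyclicDecomposition G T H B ∧ IsCycleGraph H n ∧ Even n ∧ 4 ≤ n) ∨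
    (∃ (γ δ : Type) (H : Graph γ δ) (B : γ → Set α) (n : ℕ),
      IsNiceCyclicDecomposition G T H B ∧ IsPathGraph H n ∧ 1 ≤ n) := by
  have hTfin : T.Finite := Set.finite_of_ncard_pos (by omega)
  have hpart : ∀ e a b, G.IsLink e a b → ∃ s t, Partner G T col (col e) s t ∧
      Joined G (colourClass G col (col e)) a s := fun e a b hl =>
    hcol.exists_partner hG hT hT3 hcon hins (hins.not_isLink_self hG hT (by omega)) hl rfl
  rcases exists_isAlternatingOrder (p := Partner G T col) hT3 (fun k s t h => h.1)
    (fun k s t h => h.symm) (fun k s t h => h.2.2.1)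
    (fun k s t t' h h' => ((hcol.eq_or_eq hTfin h h'.2.1 h'.2.2.2).resolve_left h'.2.2.1.symm).symm)
    (fun k k' s t h h' => hcol.partner_unique hT hT3 hcon h h')
    (fun S hS hne hcl => hcol.eq_of_partner_closed hT hcon hS hne hcl) with
    ⟨n, f, c, hn, ho⟩ | ⟨m, f, c, hm, hm4, ho⟩
  · obtain ⟨n, rfl⟩ : ∃ k, n = k + 1 := ⟨n - 1, by omega⟩
    exact .inr ⟨ℤ, ℤ, _, _, n, hcol.isNiceCyclicDecomposition hG hTfin hT hpart two_ne_zero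
      (Set.finite_Ico _ _) ho, isPathGraph_successorGraph n, by omega⟩
  · have : NeZero m := ⟨by omega⟩
    have h2 : (2 : ZMod m) ≠ 0 := by
      intro h
      have h' : ((2 : ℕ) : ZMod m) = 0 := by exact_mod_cast h
      rw [ZMod.natCast_eq_zero_iff] at h'
      have := Nat.le_of_dvd (by omega) h'
      omega
    exact .inl ⟨ZMod m, ZMod m, _, _, m, hcol.isNiceCyclicDecomposition hG hTfin hT hpart h2
      Set.finite_univ ho, isCycleGraph_successorGraph (by omega), hm, hm4⟩

lemma isGoodColouring_of_ncard_le (hTfin : T.Finite) (hT : T.ncard ≤ 2) :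
    IsGoodColouring G T fun _ => true :=
  ⟨fun _ _ _ _ _ _ => rfl, fun _ _ =>
    (Set.ncard_le_ncard (fun _ ht => ht.2) hTfin).trans hT⟩

/-- Without vertices in `T` the feasible sets are the spanning trees, and these do not change when a
single vertex is put into `T`. -/
lemma exists_ncard_symmDiff_eq_of_eq_empty (hG : ∀ v, ¬ IsIsolated G v) (hV : V(G).Finite)
    (hE : E(G).Finite) (hcon : ∀ u ∈ V(G), ∀ v ∈ V(G), Joined G E(G) u v) :
    ∃ Z ⊆ E(G), ∃ n, ∀ F ∈ (graftSystem G ∅).feasible, (symmDiff F Z).ncard = n := by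
  rcases V(G).eq_empty_or_nonempty with h0 | ⟨v, hv⟩
  · refine ⟨∅, Set.empty_subset _, 0, fun F hF => ?_⟩
    have : F = ∅ := by
      refine Set.eq_empty_of_forall_notMem fun e he => ?_
      obtain ⟨a, b, hl⟩ := G.exists_isLink_of_mem_edgeSet ((mem_feasible_iff.1 hF).1 he)
      have := hl.left_mem
      rw [h0] at this
      exact this
    simp [this]
  · have hvT : ({v} : Set α).ncard ≤ 2 := by simp
    obtain ⟨Z, hZ, n, hn⟩ := (isGoodColouring_of_ncard_le (G := G) (Set.finite_singleton v)
      hvT).exists_balancedBy hG hV hE (Set.singleton_subset_iff.2 hv)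
    refine ⟨Z, hZ, n, fun F hF => ?_⟩
    obtain ⟨hFE, hac, hcl⟩ := mem_feasible_iff.1 hF
    refine hn F hFE hac fun u hu => ?_
    have huv : Joined G F u v := by
      rcases hcl u hu with h | h
      · simp at h
      · exact h.2 v (hcon u hu v hv)
    have : {t | Joined G F u t ∧ t ∈ ({v} : Set α)} = {v} := by
      ext t
      refine ⟨fun h => h.2, ?_⟩
      rintro rfl
      exact ⟨huv, rfl⟩
    rw [this, Set.ncard_singleton]
    exact odd_one

end Characterization

end DeltaGraphic

theorem mainTheorem5 {α β : Type*} (G : Graph α β)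
    (hV : G.vertexSet.Finite) (hE : G.edgeSet.Finite)
    (hG : ∀ v, ¬ DeltaGraphic.IsIsolated G v)
    (T : Set α) (hT : T ⊆ G.vertexSet) (X : Set β) (hX : X ⊆ G.edgeSet)
    (M : DeltaGraphic.DeltaMatroid β)
    (hM : M.toSetSystem = (DeltaGraphic.graftSystem G T).twist X)
    (hconn : M.IsConnected) :
    M.IsTwistedMatroid ↔
      (T.ncard ≤ 2 ∨
        (∃ (γ δ : Type) (H : Graph γ δ) (B : γ → Set α) (n : ℕ),
          DeltaGraphic.IsNiceCyclicDecomposition G T H B ∧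
            DeltaGraphic.IsCycleGraph H n ∧ Even n ∧ 4 ≤ n) ∨
        (∃ (γ δ : Type) (H : Graph γ δ) (B : γ → Set α) (n : ℕ),
          DeltaGraphic.IsNiceCyclicDecomposition G T H B ∧
            DeltaGraphic.IsPathGraph H n ∧ 1 ≤ n)) := by
  have hins : DeltaGraphic.Inseparable G T := fun V₁ V₂ h₁ h₂ hd hU =>
    DeltaGraphic.exists_not_mix_of_twist hconn hM h₁ h₂ hd hU hX
  have hcon : ∀ u ∈ G.vertexSet, ∀ v ∈ G.vertexSet, DeltaGraphic.Joined G G.edgeSet u v :=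
    fun u hu v hv => hins.joined hG hu hv
  have hTfin := hV.subset hT
  rw [DeltaGraphic.isTwistedMatroid_iff hM hX]
  constructor
  · rintro ⟨Z, hZ, n, hn⟩
    refine or_iff_not_imp_left.2 fun hT3 => ?_
    have hne : T.Nonempty := Set.nonempty_of_ncard_ne_zero (by omega)
    have hbal : DeltaGraphic.BalancedBy G T Z n := fun F h₁ h₂ h₃ =>
      hn F ((DeltaGraphic.mem_feasible_iff_of_joined hcon hT hne).2 ⟨h₁, h₂, h₃⟩)
    obtain ⟨col, hcol⟩ := hbal.exists_isGoodColouring hE hZ hcon hT hne hins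
      (hins.not_isLink_self hG hT (by omega))
    exact hcol.exists_decomposition hG hT (by omega) hcon hins
  · intro h
    rcases T.eq_empty_or_nonempty with rfl | hne
    · exact DeltaGraphic.exists_ncard_symmDiff_eq_of_eq_empty hG hV hE hcon
    · obtain ⟨col, hcol⟩ : ∃ col, DeltaGraphic.IsGoodColouring G T col := by
        rcases h with h | ⟨γ, δ, H, B, n, hD, -⟩ | ⟨γ, δ, H, B, n, hD, -⟩
        · exact ⟨_, DeltaGraphic.isGoodColouring_of_ncard_le hTfin h⟩
        · exact hD.toIsCyclicDecomposition.exists_isGoodColouring hV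
        · exact hD.toIsCyclicDecomposition.exists_isGoodColouring hV
      obtain ⟨Z, hZ, n, hn⟩ := hcol.exists_balancedBy hG hV hE hT
      refine ⟨Z, hZ, n, fun F hF => ?_⟩
      obtain ⟨h₁, h₂, h₃⟩ := (DeltaGraphic.mem_feasible_iff_of_joined hcon hT hne).1 hF
      exact hn F h₁ h₂ h₃
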